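/- Let $k$ be an algebraically closed field. For a finite quiver $Q$ with $n$ vertices, $m$ arrows and $c$ connected components put $\beta_1(Q)=m-n+c$. For an ideal $I\subseteq kQ$, a relation $r\in I$, $r\neq 0$, is minimal if no non-zero proper subsum of $r$ lies in $I$. For a vertex $*$ let $\pi_1(Q,I,*)$ be the group of closed walks at $*$ (paths in the arrows and their formal inverses) modulo the homotopy relation generated by $\alpha^{-1}\alpha\sim s(\alpha)$, $\alpha\alpha^{-1}\sim t(\alpha)$ for the arrows $\alpha$, and $p\sim q$ whenever $p,q$ occur with non-zero coefficients in a common minimal relation of $I$. If $Q$ is connected this group is, up to isomorphism, independent of $*$ and denoted $\pi_1(Q,I)$; in general $\pi_1(Q,I)$ is the direct product of the fundamental groups of the connected components of $(Q,I)$. Write $\pi_1(Q)=\pi_1(Q,0)$. For a finite-dimensional algebra $A$ let $$\pi_1\text{-}\mathrm{rank}(A)=\max\{\dim_k \mathrm{Hom}(\pi_1(Q,I),k^+) : A\cong kQ/I,\ Q \text{ a finite quiver},\ I \text{ an admissible ideal}\}.$$ Let $A$ be a connected monomial algebra, presented by $\nu_A:kQ_A\to A$ with $Q_A$ a finite quiver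 and $I_A=\ker\nu_A$ an admissible ideal generated by paths. Let $B\subseteq A$ be a monomial subalgebra (not necessarily with the same unit) such that $Q_B$ is a subquiver of $Q_A$, presented compatibly: $\nu_B:kQ_B\to B$ is surjective, $I_B=\ker\nu_B$ is an admissible ideal generated by paths, and $\nu_B$ is the restriction of $\nu_A$ to $kQ_B$. Let $T$ be a maximal tree of $Q_A$ that extends a maximal forest of $Q_B$ (a maximal tree of each connected component of $Q_B$), and let $Q_{A|B}=Q_{A|B,T}$ be the quiver with vertices $(Q_A)_0$ and arrows $((Q_A)_1\setminus (Q_B)_1)\cup T$. Let $*$ be a vertex of $Q_A$, let $N_B\subseteq\pi_1(Q_A,I_A,*)$ be the (automatically normal) subgroup generated by the classes $[v^{-1}(u')^{-1}uv]$ with $u,u'$ parallel walks in $Q_B$ and $v$ a walk in $Q_A$ from $*$ to the source of $u$, and let $\pi_1(A|B)=\pi_1(Q_A,I_A,*)/N_B$ be the contracted fundamental group. Then: 1. $\beta_1(Q_{A|B})=\beta_1(Q_A)-\beta_1(Q_B)$. 2. The homomorphism $\pi_1(Q_B,I_B)^{\mathrm{ab}}\to\pi_1(Q_A,I_A)^{\mathrm{ab}}$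 induced by the inclusion $Q_B\subseteq Q_A$ (and by any choice of walks from $*$ to base points of the connected components of $Q_B$) is injective, and $$\pi_1(A|B)^{\mathrm{ab}}\cong \pi_1(Q_{A|B})^{\mathrm{ab}}\cong \pi_1(Q_A,I_A)^{\mathrm{ab}}/\pi_1(Q_B,I_B)^{\mathrm{ab}},$$ where the isomorphism between the first and the last group is the one induced by the identity of $\pi_1(Q_A,I_A)$. 3. The maxima defining $\pi_1\text{-}\mathrm{rank}(A)$ and $\pi_1\text{-}\mathrm{rank}(B)$ exist, $\mathrm{Hom}(\pi_1(Q_{A|B}),k^+)$ is finite-dimensional, and $$\dim_k\mathrm{Hom}(\pi_1(Q_{A|B}),k^+)=\pi_1\text{-}\mathrm{rank}(A)-\pi_1\text{-}\mathrm{rank}(B).$$ -/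

import Mathlib

open Quiver

universe t w v u

noncomputable section

namespace QuiverAlg

/-! ### The path algebra of a finite quiver -/

/-- All paths of a quiver `V`, of any length (including the trivial ones) and with any endpoints. -/
abbrev AnyPath (V : Type u) [Quiver.{v} V] : Type (max u v) := Σ a b : V, Quiver.Path a b

/-- The underlying vector space of the path algebra `kQ`: finite formal linear combinations
of paths. -/
def PathAlgebra (k : Type w) (V : Type u) [Field k] [Quiver.{v} V] : Type (max u v w) :=
  AnyPath V →₀ k

section PathAlgebra

variable {k : Type w} {V : Type u} [Field k] [Quiver.{v} V]

instance : AddCommGroup (PathAlgebra k V) := inferInstanceAs (AddCommGroup (AnyPath V →₀ k))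

instance : Module k (PathAlgebra k V) := inferInstanceAs (Module k (AnyPath V →₀ k))

/-- A linear combination of paths, seen as an element of the path algebra. -/
def PathAlgebra.ofFinsupp (r : AnyPath V →₀ k) : PathAlgebra k V := r

/-- The coefficients of an element of the path algebra. -/
def PathAlgebra.toFinsupp (r : PathAlgebra k V) : AnyPath V →₀ k := r

/-- The basis element given by a path. -/
def PathAlgebra.path (k : Type w) [Field k] (p : AnyPath V) : PathAlgebra k V :=
  PathAlgebra.ofFinsupp (Finsupp.single p 1)

open Classical in
/-- The product `p q` of two paths, composed from right to left: it is the path `q` followed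
by the path `p` if `q` ends where `p` starts, and zero otherwise. -/
def PathAlgebra.mulPath (p q : AnyPath V) : PathAlgebra k V :=
  if h : q.2.1 = p.1 then
    PathAlgebra.path k ⟨q.1, p.2.1, (q.2.2.cast rfl h).comp p.2.2⟩
  else 0

/-- The bilinear extension of the product of paths. -/
def PathAlgebra.mulBilin :
    (AnyPath V →₀ k) →ₗ[k] (AnyPath V →₀ k) →ₗ[k] PathAlgebra k V :=
  Finsupp.linearCombination k fun p =>
    Finsupp.linearCombination k fun q => PathAlgebra.mulPath p q

instance : Mul (PathAlgebra k V) := ⟨fun x y => PathAlgebra.mulBilin x.toFinsupp y.toFinsupp⟩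

instance [Fintype V] : One (PathAlgebra k V) :=
  ⟨∑ a : V, PathAlgebra.path k ⟨a, a, Path.nil⟩⟩

theorem PathAlgebra.path_mul_path (p q : AnyPath V) :
    PathAlgebra.path k p * PathAlgebra.path k q = PathAlgebra.mulPath p q := by
  change PathAlgebra.mulBilin (Finsupp.single p 1) (Finsupp.single q 1) = _
  simp [PathAlgebra.mulBilin]

theorem PathAlgebra.mulPath_comp {a b c : V} (p : Quiver.Path b c) (q : Quiver.Path a b) :
    PathAlgebra.mulPath (k := k) ⟨b, c, p⟩ ⟨a, b, q⟩ =
      PathAlgebra.path k ⟨a, c, q.comp p⟩ := by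
  simp [PathAlgebra.mulPath]

theorem PathAlgebra.mulPath_of_ne {p q : AnyPath V} (h : q.2.1 ≠ p.1) :
    PathAlgebra.mulPath (k := k) p q = 0 := by
  simp [PathAlgebra.mulPath, h]

theorem PathAlgebra.add_mul' (x y z : PathAlgebra k V) : (x + y) * z = x * z + y * z := by
  change PathAlgebra.mulBilin (x.toFinsupp + y.toFinsupp) z.toFinsupp = _
  rw [map_add]; rfl

theorem PathAlgebra.mul_add' (x y z : PathAlgebra k V) : x * (y + z) = x * y + x * z := by
  change PathAlgebra.mulBilin x.toFinsupp (y.toFinsupp + z.toFinsupp) = _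
  rw [map_add]; rfl

theorem PathAlgebra.smul_mul' (c : k) (x y : PathAlgebra k V) : (c • x) * y = c • (x * y) := by
  change PathAlgebra.mulBilin (c • x.toFinsupp) y.toFinsupp = _
  rw [map_smul]; rfl

theorem PathAlgebra.mul_smul' (c : k) (x y : PathAlgebra k V) : x * (c • y) = c • (x * y) := by
  change PathAlgebra.mulBilin x.toFinsupp (c • y.toFinsupp) = _
  rw [map_smul]; rfl

theorem PathAlgebra.zero_mul' (x : PathAlgebra k V) : 0 * x = 0 := by
  simpa using PathAlgebra.smul_mul' (0 : k) 0 x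

theorem PathAlgebra.mul_zero' (x : PathAlgebra k V) : x * 0 = 0 := by
  simpa using PathAlgebra.mul_smul' (0 : k) x 0

/-- Linear statements about the path algebra can be checked on paths. -/
theorem PathAlgebra.induction {P : PathAlgebra k V → Prop} (x : PathAlgebra k V)
    (zero : P 0) (add : ∀ x y, P x → P y → P (x + y))
    (smul : ∀ (c : k) (p : AnyPath V), P (c • PathAlgebra.path k p)) : P x := by
  refine Finsupp.induction_linear (motive := P) x zero (fun f g hf hg => add f g hf hg)
    fun p c => ?_
  have h := smul c p
  have e : c • PathAlgebra.path k p = PathAlgebra.ofFinsupp (Finsupp.single p c) := by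
    change c • Finsupp.single p (1 : k) = Finsupp.single p c
    simp
  rw [e] at h
  exact h

theorem PathAlgebra.path_assoc (p q r : AnyPath V) :
    PathAlgebra.path k p * PathAlgebra.path k q * PathAlgebra.path k r =
      PathAlgebra.path k p * (PathAlgebra.path k q * PathAlgebra.path k r) := by
  obtain ⟨c, d, p⟩ := p
  obtain ⟨b, c', q⟩ := q
  obtain ⟨a, b', r⟩ := r
  by_cases h : c' = c
  · subst h
    by_cases h' : b' = b
    · subst h'
      simp only [PathAlgebra.path_mul_path, PathAlgebra.mulPath_comp, Path.comp_assoc]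
    · rw [PathAlgebra.path_mul_path, PathAlgebra.path_mul_path, PathAlgebra.mulPath_comp,
        PathAlgebra.path_mul_path, PathAlgebra.mulPath_of_ne h', PathAlgebra.mulPath_of_ne h',
        PathAlgebra.mul_zero']
  · rw [PathAlgebra.path_mul_path, PathAlgebra.path_mul_path, PathAlgebra.mulPath_of_ne h,
      PathAlgebra.zero_mul']
    by_cases h' : b' = b
    · subst h'
      rw [PathAlgebra.mulPath_comp, PathAlgebra.path_mul_path, PathAlgebra.mulPath_of_ne h]
    · rw [PathAlgebra.mulPath_of_ne h', PathAlgebra.mul_zero']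

theorem PathAlgebra.mul_assoc' (x y z : PathAlgebra k V) : x * y * z = x * (y * z) := by
  induction x using PathAlgebra.induction with
  | zero => simp only [PathAlgebra.zero_mul']
  | add x x' hx hx' => simp only [PathAlgebra.add_mul', hx, hx']
  | smul c p =>
    induction y using PathAlgebra.induction with
    | zero => simp only [PathAlgebra.zero_mul', PathAlgebra.mul_zero']
    | add y y' hy hy' => simp only [PathAlgebra.add_mul', PathAlgebra.mul_add', hy, hy']
    | smul d q =>
      induction z using PathAlgebra.induction with
      | zero => simp only [PathAlgebra.mul_zero']
      | add z z' hz hz' => simp only [PathAlgebra.mul_add', hz, hz']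
      | smul e r =>
        simp only [PathAlgebra.smul_mul', PathAlgebra.mul_smul', PathAlgebra.path_assoc]

theorem PathAlgebra.one_mul' [Fintype V] (x : PathAlgebra k V) : 1 * x = x := by
  classical
  induction x using PathAlgebra.induction with
  | zero => exact PathAlgebra.mul_zero' _
  | add x y hx hy => rw [PathAlgebra.mul_add', hx, hy]
  | smul c p =>
    rw [PathAlgebra.mul_smul']
    congr 1
    obtain ⟨a, b, p⟩ := p
    change PathAlgebra.mulBilin (∑ a : V, Finsupp.single (⟨a, a, Path.nil⟩ : AnyPath V) (1 : k))
      (Finsupp.single ⟨a, b, p⟩ 1) = _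
    rw [map_sum, LinearMap.sum_apply, Finset.sum_eq_single b]
    · exact (PathAlgebra.path_mul_path _ _).trans (PathAlgebra.mulPath_comp _ _)
    · intro c _ hc
      exact (PathAlgebra.path_mul_path _ _).trans (PathAlgebra.mulPath_of_ne hc.symm)
    · simp

theorem PathAlgebra.mul_one' [Fintype V] (x : PathAlgebra k V) : x * 1 = x := by
  classical
  induction x using PathAlgebra.induction with
  | zero => exact PathAlgebra.zero_mul' _
  | add x y hx hy => rw [PathAlgebra.add_mul', hx, hy]
  | smul c p =>
    rw [PathAlgebra.smul_mul']
    congr 1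
    obtain ⟨a, b, p⟩ := p
    change PathAlgebra.mulBilin (Finsupp.single ⟨a, b, p⟩ 1)
      (∑ a : V, Finsupp.single (⟨a, a, Path.nil⟩ : AnyPath V) (1 : k)) = _
    rw [map_sum, Finset.sum_eq_single a]
    · refine (PathAlgebra.path_mul_path _ _).trans ((PathAlgebra.mulPath_comp _ _).trans ?_)
      rw [Path.nil_comp]
    · intro c _ hc
      exact (PathAlgebra.path_mul_path _ _).trans (PathAlgebra.mulPath_of_ne hc)
    · simp

instance [Fintype V] : Ring (PathAlgebra k V) where
  __ := (inferInstance : AddCommGroup (PathAlgebra k V))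
  mul := (· * ·)
  one := 1
  left_distrib := PathAlgebra.mul_add'
  right_distrib := PathAlgebra.add_mul'
  zero_mul := PathAlgebra.zero_mul'
  mul_zero := PathAlgebra.mul_zero'
  mul_assoc := PathAlgebra.mul_assoc'
  one_mul := PathAlgebra.one_mul'
  mul_one := PathAlgebra.mul_one'

instance [Fintype V] : Algebra k (PathAlgebra k V) :=
  Algebra.ofModule PathAlgebra.smul_mul' PathAlgebra.mul_smul'

end PathAlgebra

/-! ### Ideals and presentations -/

section Ideals

variable {k : Type w} {V : Type u} [Field k] [Quiver.{v} V] [Fintype V]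

/-- An ideal `I` of `kQ` is admissible if `J ^ m ⊆ I ⊆ J ^ 2` for some `m`, where `J` is the
ideal generated by the arrows; here `J ^ m` is the span of the paths of length at least `m`. -/
def IsAdmissible (I : TwoSidedIdeal (PathAlgebra k V)) : Prop :=
  (∀ x ∈ I, ∀ p ∈ x.toFinsupp.support, 2 ≤ p.2.2.length) ∧
    ∃ m : ℕ, ∀ p : AnyPath V, m ≤ p.2.2.length → PathAlgebra.path k p ∈ I

/-- An ideal of `kQ` is monomial if it is generated by a set of paths of length at least two. -/
def IsMonomialIdeal (I : TwoSidedIdeal (PathAlgebra k V)) : Prop :=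
  ∃ Z : Set (AnyPath V), (∀ p ∈ Z, 2 ≤ p.2.2.length) ∧
    I = TwoSidedIdeal.span (PathAlgebra.path k '' Z)

/-- `ν` presents `A` as `kQ / I` with `I` an admissible ideal. -/
def IsAdmissiblePresentation {A : Type*} [Ring A] [Algebra k A]
    (ν : PathAlgebra k V →ₐ[k] A) : Prop :=
  Function.Surjective ν ∧ IsAdmissible (TwoSidedIdeal.ker ν)

/-- `ν` presents `A` as a monomial algebra `kQ / I`, with `I` an admissible ideal generated by
paths. -/
def IsMonomialPresentation {A : Type*} [Ring A] [Algebra k A]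
    (ν : PathAlgebra k V →ₐ[k] A) : Prop :=
  IsAdmissiblePresentation ν ∧ IsMonomialIdeal (TwoSidedIdeal.ker ν)

open Classical in
/-- A minimal relation: a non-zero element of `I` such that no non-zero proper subsum of it
lies in `I`. -/
def IsMinimalRelation (I : TwoSidedIdeal (PathAlgebra k V)) (r : PathAlgebra k V) : Prop :=
  r ∈ I ∧ r ≠ 0 ∧ ∀ S : Set (AnyPath V),
    PathAlgebra.ofFinsupp (r.toFinsupp.filter (· ∈ S)) ∈ I →
      r.toFinsupp.filter (· ∈ S) = 0 ∨ r.toFinsupp.filter (· ∈ S) = r.toFinsupp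

end Ideals

/-- An algebra is connected if it is non-zero and not a product of two non-zero algebras, that
is, its only central idempotents are `0` and `1`. -/
def IsConnectedAlgebra (A : Type*) [Ring A] : Prop :=
  Nontrivial A ∧ ∀ e : A, IsIdempotentElem e → (∀ a : A, e * a = a * e) → e = 0 ∨ e = 1

/-! ### Walks, homotopy, and the fundamental group of a bound quiver -/

/-- A walk: a path in the quiver to which a formal inverse of each arrow has been added. -/
def Walk {V : Type u} [Quiver.{v} V] (a b : V) : Type (max u v) :=
  @Quiver.Path (Symmetrify V) _ a b

section Walk

variable {V : Type u} [Quiver.{v} V]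

/-- The trivial walk. -/
def Walk.nil (a : V) : Walk a a := @Quiver.Path.nil (Symmetrify V) _ a

/-- The walk `u` followed by the walk `w`. -/
def Walk.comp {a b c : V} (u : Walk a b) (w : Walk b c) : Walk a c :=
  @Quiver.Path.comp (Symmetrify V) _ a b c u w

/-- The formal inverse of a walk. -/
def Walk.inv {a b : V} (u : Walk a b) : Walk b a :=
  @Quiver.Path.reverse (Symmetrify V) _ _ a b u

/-- An arrow, seen as a walk. -/
def Walk.arrow {a b : V} (α : a ⟶ b) : Walk a b :=
  @Quiver.Path.cons (Symmetrify V) _ a a b Quiver.Path.nil (Sum.inl α)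

/-- The formal inverse of an arrow, seen as a walk. -/
def Walk.invArrow {a b : V} (α : a ⟶ b) : Walk b a :=
  @Quiver.Path.cons (Symmetrify V) _ b b a Quiver.Path.nil (Sum.inr α)

/-- A path, seen as a walk. -/
def Walk.ofPath {a b : V} (p : Quiver.Path a b) : Walk a b := Symmetrify.of.mapPath p

theorem Walk.nil_comp {a b : V} (u : Walk a b) : (Walk.nil a).comp u = u :=
  @Quiver.Path.nil_comp (Symmetrify V) _ a b u

theorem Walk.comp_nil {a b : V} (u : Walk a b) : u.comp (Walk.nil b) = u := rfl

theorem Walk.comp_assoc {a b c d : V} (u : Walk a b) (w : Walk b c) (z : Walk c d) :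
    (u.comp w).comp z = u.comp (w.comp z) :=
  @Quiver.Path.comp_assoc (Symmetrify V) _ a b c d u w z

theorem Walk.inv_inv {a b : V} (u : Walk a b) : u.inv.inv = u :=
  @Quiver.Path.reverse_reverse (Symmetrify V) _ _ a b u

theorem Walk.inv_comp {a b c : V} (u : Walk a b) (w : Walk b c) :
    (u.comp w).inv = w.inv.comp u.inv :=
  @Quiver.Path.reverse_comp (Symmetrify V) _ _ a b c u w

theorem Walk.inv_nil (a : V) : (Walk.nil a).inv = Walk.nil a := rfl

theorem Walk.inv_arrow {a b : V} (α : a ⟶ b) : (Walk.arrow α).inv = Walk.invArrow α := rfl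

theorem Walk.inv_invArrow {a b : V} (α : a ⟶ b) : (Walk.invArrow α).inv = Walk.arrow α := rfl

/-- Walks are built from the trivial ones by appending arrows and inverse arrows. -/
theorem Walk.induction {a : V} {P : ∀ {b : V}, Walk a b → Prop} {b : V} (u : Walk a b)
    (nil : P (Walk.nil a))
    (arrow : ∀ {b c : V} (u : Walk a b) (α : b ⟶ c), P u → P (u.comp (Walk.arrow α)))
    (invArrow : ∀ {b c : V} (u : Walk a b) (α : c ⟶ b), P u → P (u.comp (Walk.invArrow α))) :
    P u := by
  refine @Quiver.Path.rec (Symmetrify V) _ a (fun b u => @P b u) nil ?_ b u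
  intro b c p e ih
  rcases e with α | α
  · exact arrow p α ih
  · exact invArrow p α ih

end Walk

section Pi1

variable {k : Type w} {V : Type u} [Field k] [Quiver.{v} V] [Fintype V]

/-- The homotopy relation on walks generated by `α⁻¹ α ∼ s(α)`, `α α⁻¹ ∼ t(α)` and `p ∼ q`
whenever `p` and `q` appear together in a minimal relation with non-zero coefficients. -/
inductive Homotopic (I : TwoSidedIdeal (PathAlgebra k V)) :
    ∀ {a b : V}, Walk a b → Walk a b → Prop
  | refl {a b : V} (u : Walk a b) : Homotopic I u u
  | symm {a b : V} {u w : Walk a b} : Homotopic I u w → Homotopic I w u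
  | trans {a b : V} {u w z : Walk a b} : Homotopic I u w → Homotopic I w z → Homotopic I u z
  | comp {a b c : V} {u u' : Walk a b} {w w' : Walk b c} :
      Homotopic I u u' → Homotopic I w w' → Homotopic I (u.comp w) (u'.comp w')
  | inv_arrow {a b : V} (α : a ⟶ b) :
      Homotopic I ((Walk.arrow α).comp (Walk.invArrow α)) (Walk.nil a)
  | arrow_inv {a b : V} (α : a ⟶ b) :
      Homotopic I ((Walk.invArrow α).comp (Walk.arrow α)) (Walk.nil b)
  | rel {a b : V} (p q : Quiver.Path a b) (r : PathAlgebra k V) : IsMinimalRelation I r →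
      r.toFinsupp ⟨a, b, p⟩ ≠ 0 → r.toFinsupp ⟨a, b, q⟩ ≠ 0 →
      Homotopic I (Walk.ofPath p) (Walk.ofPath q)

variable (I : TwoSidedIdeal (PathAlgebra k V))

theorem Homotopic.cancel_mid {a b c d : V} {u : Walk a b} {e : Walk b c} {e' : Walk c b}
    {w : Walk b d} (h : Homotopic I (e.comp e') (Walk.nil b)) :
    Homotopic I ((u.comp e).comp (e'.comp w)) (u.comp w) := by
  have h2 := Homotopic.comp (Homotopic.comp (Homotopic.refl (I := I) u) h)
    (Homotopic.refl (I := I) w)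
  simpa only [Walk.comp_nil, Walk.comp_assoc, Walk.nil_comp] using h2

theorem Homotopic.comp_inv {a b : V} (u : Walk a b) :
    Homotopic I (u.comp u.inv) (Walk.nil a) := by
  induction u using Walk.induction with
  | nil => exact Homotopic.refl _
  | arrow u α ih =>
    rw [Walk.inv_comp, Walk.inv_arrow]
    exact (Homotopic.cancel_mid I (Homotopic.inv_arrow α)).trans ih
  | invArrow u α ih =>
    rw [Walk.inv_comp, Walk.inv_invArrow]
    exact (Homotopic.cancel_mid I (Homotopic.arrow_inv α)).trans ih

theorem Homotopic.inv_comp {a b : V} (u : Walk a b) :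
    Homotopic I (u.inv.comp u) (Walk.nil b) := by
  simpa only [Walk.inv_inv] using Homotopic.comp_inv I u.inv

theorem Homotopic.inv {I : TwoSidedIdeal (PathAlgebra k V)} {a b : V} {u w : Walk a b}
    (h : Homotopic I u w) : Homotopic I u.inv w.inv := by
  have h1 : Homotopic I (u.inv.comp (w.comp w.inv)) u.inv := by
    simpa only [Walk.comp_nil] using
      Homotopic.comp (Homotopic.refl (I := I) u.inv) (Homotopic.comp_inv I w)
  have h2 : Homotopic I (u.inv.comp (w.comp w.inv)) (u.inv.comp (u.comp w.inv)) :=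
    Homotopic.comp (Homotopic.refl _) (Homotopic.comp h.symm (Homotopic.refl _))
  have h3 : Homotopic I (u.inv.comp (u.comp w.inv)) w.inv := by
    simpa only [Walk.nil_comp, Walk.comp_assoc] using
      Homotopic.comp (Homotopic.inv_comp I u) (Homotopic.refl (I := I) w.inv)
  exact h1.symm.trans (h2.trans h3)

/-- Homotopy of closed walks at `x`. -/
def homotopySetoid (x : V) : Setoid (Walk x x) where
  r := Homotopic I
  iseqv := ⟨Homotopic.refl, Homotopic.symm, Homotopic.trans⟩

/-- The fundamental group `π₁(Q, I, x)`: closed walks at `x` up to homotopy. -/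
def Pi1 (x : V) : Type (max u v) := Quotient (homotopySetoid I x)

variable {x : V}

/-- The homotopy class of a closed walk. -/
def Pi1.mk (u : Walk x x) : Pi1 I x := Quotient.mk (homotopySetoid I x) u

/-- Products are concatenations, from right to left: `[u] [w]` is the class of `w`
followed by `u`. -/
instance : Group (Pi1 I x) where
  mul := Quotient.map₂ (fun u w => w.comp u) fun _ _ h _ _ h' => Homotopic.comp h' h
  one := Pi1.mk I (Walk.nil x)
  inv := Quotient.map (fun u => u.inv) fun _ _ h => Homotopic.inv h
  mul_assoc := by
    rintro ⟨a⟩ ⟨b⟩ ⟨c⟩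
    exact congrArg (Pi1.mk I) (Walk.comp_assoc c b a).symm
  one_mul := by
    rintro ⟨a⟩
    exact congrArg (Pi1.mk I) (Walk.comp_nil a)
  mul_one := by
    rintro ⟨a⟩
    exact congrArg (Pi1.mk I) (Walk.nil_comp a)
  inv_mul_cancel := by
    rintro ⟨a⟩
    exact Quotient.sound (s := homotopySetoid I x) (Homotopic.comp_inv I a)

theorem Pi1.mk_mul (u w : Walk x x) : Pi1.mk I u * Pi1.mk I w = Pi1.mk I (w.comp u) := rfl

theorem Pi1.mk_inv (u : Walk x x) : (Pi1.mk I u)⁻¹ = Pi1.mk I u.inv := rfl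

theorem Pi1.mk_one : (1 : Pi1 I x) = Pi1.mk I (Walk.nil x) := rfl

theorem Pi1.mk_eq {u w : Walk x x} (h : Homotopic I u w) : Pi1.mk I u = Pi1.mk I w :=
  Quotient.sound (s := homotopySetoid I x) h

/-- A chosen vertex of a connected component. -/
def componentBase (c : WeaklyConnectedComponent V) : V := Quotient.out (s := zigzagSetoid V) c

/-- The fundamental group `π₁(Q, I)` of a bound quiver that need not be connected: the direct
product of the fundamental groups of its connected components. -/
abbrev Pi1Prod : Type (max u v) := ∀ c : WeaklyConnectedComponent V, Pi1 I (componentBase c)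

end Pi1

/-- The vector space `Hom(G, k⁺)` of group homomorphisms to the additive group of `k`. -/
abbrev DualGroup (k : Type*) [Field k] (G : Type*) [Group G] : Type _ := Additive G →+ k

/-- The first Betti number `m - n + c` of a finite quiver with `n` vertices, `m` arrows and `c`
connected components. -/
def betti (V : Type u) [Quiver.{v} V] : ℤ :=
  (Nat.card (Total V) : ℤ) - Nat.card V + Nat.card (WeaklyConnectedComponent V)

/-- The dimensions of `Hom(π₁(Q, I), k⁺)`, over all presentations of `A` as `kQ / I`
with `Q` a finite quiver and `I` an admissible ideal. The value does not depend on the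
universes in which the finite quivers live. -/
def pi1Dims (k : Type w) [Field k] (A : Type t) [Ring A] [Algebra k A] : Set ℕ :=
  {d | ∃ (V : Type u) (_ : Fintype V) (_ : Quiver.{v} V) (_ : ∀ a b : V, Finite (a ⟶ b))
    (ν : PathAlgebra k V →ₐ[k] A), IsAdmissiblePresentation ν ∧
      Module.rank k (DualGroup k (Pi1Prod (TwoSidedIdeal.ker ν))) = d}

/-- The `π₁`-rank of `A`, the maximum of the dimensions in `pi1Dims k A`. -/
def pi1Rank (k : Type w) [Field k] (A : Type t) [Ring A] [Algebra k A] : ℕ :=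
  sSup (pi1Dims.{t, w, v, u} k A)

/-! ### Subquivers -/

/-- A subquiver: a set of vertices and a set of arrows between them. -/
structure Subquiver (V : Type u) [Quiver.{v} V] where
  /-- the vertices of the subquiver -/
  verts : Set V
  /-- the arrows of the subquiver -/
  arrows : WideSubquiver V
  source_mem : ∀ {a b : V} {α : a ⟶ b}, α ∈ arrows a b → a ∈ verts
  target_mem : ∀ {a b : V} {α : a ⟶ b}, α ∈ arrows a b → b ∈ verts

section Subquiver

variable {k : Type w} {V : Type u} [Field k] [Quiver.{v} V]

/-- The vertices of a subquiver, as a type. -/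
abbrev Subquiver.Vert (Q : Subquiver V) : Type u := {a : V // a ∈ Q.verts}

instance (Q : Subquiver V) : Quiver.{v} Q.Vert :=
  ⟨fun a b => {α : a.1 ⟶ b.1 // α ∈ Q.arrows a.1 b.1}⟩

instance [Fintype V] (Q : Subquiver V) : Fintype Q.Vert := Fintype.ofFinite _

instance [Fintype V] (W : WideSubquiver V) : Fintype W := inferInstanceAs (Fintype V)

/-- The inclusion of a subquiver. -/
def Subquiver.incl (Q : Subquiver V) : Q.Vert ⥤q V where
  obj := Subtype.val
  map α := α.1

/-- A path in a subquiver, seen as a path in the whole quiver. -/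
def Subquiver.mapPath (Q : Subquiver V) (p : AnyPath Q.Vert) : AnyPath V :=
  ⟨p.1.1, p.2.1.1, Q.incl.mapPath p.2.2⟩

/-- A walk in a subquiver, seen as a walk in the whole quiver. -/
def Subquiver.mapWalk (Q : Subquiver V) {a b : Q.Vert} (u : Walk a b) : Walk a.1 b.1 :=
  Q.incl.symmetrify.mapPath u

/-- The inclusion `kQ' → kQ` of path algebras for a subquiver `Q'` of `Q`. -/
def Subquiver.mapAlg (Q : Subquiver V) : PathAlgebra k Q.Vert →ₗ[k] PathAlgebra k V :=
  Finsupp.lmapDomain k k Q.mapPath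

theorem Subquiver.incl_mapPath_injective (Q : Subquiver V) {a b : Q.Vert}
    {p q : Quiver.Path a b} (h : Q.incl.mapPath p = Q.incl.mapPath q) : p = q := by
  induction p with
  | nil =>
    cases q with
    | nil => rfl
    | cons q' e =>
      have := congrArg Quiver.Path.length h
      simp at this
  | @cons b c p e ih =>
    cases q with
    | nil =>
      have := congrArg Quiver.Path.length h
      simp at this
    | @cons b' _ q' e' =>
      simp only [Prefunctor.mapPath_cons, Quiver.Path.cons.injEq] at h
      obtain ⟨h1, h2, h3⟩ := h
      have hb : b = b' := Subtype.ext h1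
      subst hb
      have hp := ih (eq_of_heq h2)
      have he : e = e' := Subtype.ext (eq_of_heq h3)
      rw [hp, he]

theorem Subquiver.mapPath_injective (Q : Subquiver V) : Function.Injective Q.mapPath := by
  rintro ⟨⟨a, ha⟩, ⟨b, hb⟩, p⟩ ⟨⟨a', ha'⟩, ⟨b', hb'⟩, q⟩ h
  have h1 : a = a' := congrArg Sigma.fst h
  subst h1
  have h2 : b = b' := congrArg (fun z : AnyPath V => z.2.1) h
  subst h2
  have h3 : Q.incl.mapPath p = Q.incl.mapPath q :=
    eq_of_heq (Sigma.mk.inj (eq_of_heq (Sigma.mk.inj h).2)).2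
  have h4 : p = q := Q.incl_mapPath_injective h3
  subst h4
  rfl

theorem Subquiver.mapWalk_comp (Q : Subquiver V) {a b c : Q.Vert} (u : Walk a b)
    (w : Walk b c) : Q.mapWalk (u.comp w) = (Q.mapWalk u).comp (Q.mapWalk w) :=
  Q.incl.symmetrify.mapPath_comp u w

theorem Subquiver.mapWalk_ofPath (Q : Subquiver V) {a b : Q.Vert} (p : Quiver.Path a b) :
    Q.mapWalk (Walk.ofPath p) = Walk.ofPath (Q.incl.mapPath p) := by
  induction p with
  | nil => rfl
  | cons p e ih =>
    exact congrArg (fun z => Walk.comp z (Walk.arrow (Q.incl.map e))) ih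

open Classical in
theorem Subquiver.filter_mapAlg (Q : Subquiver V) (r : AnyPath Q.Vert →₀ k)
    (S : Set (AnyPath V)) :
    (Finsupp.mapDomain Q.mapPath r).filter (· ∈ S) =
      Finsupp.mapDomain Q.mapPath (r.filter (· ∈ Q.mapPath ⁻¹' S)) := by
  induction r using Finsupp.induction_linear with
  | zero => rw [Finsupp.filter_zero, Finsupp.mapDomain_zero, Finsupp.filter_zero]
  | add f g hf hg => simp only [Finsupp.mapDomain_add, Finsupp.filter_add, hf, hg]
  | single p c =>
    by_cases h : Q.mapPath p ∈ S
    · rw [Finsupp.mapDomain_single, Finsupp.filter_single_of_pos _ h,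
        Finsupp.filter_single_of_pos _ (show p ∈ Q.mapPath ⁻¹' S from h),
        Finsupp.mapDomain_single]
    · rw [Finsupp.mapDomain_single, Finsupp.filter_single_of_neg _ h,
        Finsupp.filter_single_of_neg _ (show p ∉ Q.mapPath ⁻¹' S from h),
        Finsupp.mapDomain_zero]

variable [Fintype V]

/-- Compatibility of ideals along a subquiver: `I'` is the intersection of `I` with `kQ'`. -/
def Subquiver.Compatible (Q : Subquiver V) (I' : TwoSidedIdeal (PathAlgebra k Q.Vert))
    (I : TwoSidedIdeal (PathAlgebra k V)) : Prop :=
  ∀ x, x ∈ I' ↔ Q.mapAlg x ∈ I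

/-- The kernels of a relative presentation are compatible. -/
theorem Subquiver.compatible_ker {A B : Type*} [Ring A] [Algebra k A] [Ring B] [Algebra k B]
    {Q : Subquiver V} {ι : B →ₙₐ[k] A} (hι : Function.Injective ι)
    {νA : PathAlgebra k V →ₐ[k] A} {νB : PathAlgebra k Q.Vert →ₐ[k] B}
    (h : ∀ x, ι (νB x) = νA (Q.mapAlg x)) :
    Q.Compatible (TwoSidedIdeal.ker νB) (TwoSidedIdeal.ker νA) := by
  intro x
  rw [TwoSidedIdeal.mem_ker, TwoSidedIdeal.mem_ker, ← h, map_eq_zero_iff ι hι]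

theorem IsMinimalRelation.map {Q : Subquiver V} {I' : TwoSidedIdeal (PathAlgebra k Q.Vert)}
    {I : TwoSidedIdeal (PathAlgebra k V)} (hI : Q.Compatible I' I) {r : PathAlgebra k Q.Vert}
    (hr : IsMinimalRelation I' r) : IsMinimalRelation I (Q.mapAlg r) := by
  classical
  obtain ⟨h1, h2, h3⟩ := hr
  have hinj := Finsupp.mapDomain_injective (M := k) Q.mapPath_injective
  refine ⟨(hI r).1 h1, fun h0 => h2 (hinj (h0.trans Finsupp.mapDomain_zero.symm)), fun S hS => ?_⟩
  have e : (Q.mapAlg r).toFinsupp.filter (· ∈ S) =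
      Finsupp.mapDomain Q.mapPath (r.toFinsupp.filter (· ∈ Q.mapPath ⁻¹' S)) := by
    rw [← Q.filter_mapAlg]
    rfl
  rw [e] at hS ⊢
  rcases h3 (Q.mapPath ⁻¹' S) ((hI _).2 hS) with h | h
  · left
    rw [h, Finsupp.mapDomain_zero]
  · right
    rw [h]
    rfl

theorem Homotopic.mapWalk {Q : Subquiver V} {I' : TwoSidedIdeal (PathAlgebra k Q.Vert)}
    {I : TwoSidedIdeal (PathAlgebra k V)} (hI : Q.Compatible I' I) {a b : Q.Vert}
    {u w : Walk a b} (h : Homotopic I' u w) : Homotopic I (Q.mapWalk u) (Q.mapWalk w) := by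
  induction h with
  | refl u => exact Homotopic.refl _
  | symm _ ih => exact ih.symm
  | trans _ _ ih ih' => exact ih.trans ih'
  | comp _ _ ih ih' =>
    rw [Q.mapWalk_comp, Q.mapWalk_comp]
    exact ih.comp ih'
  | inv_arrow α => exact Homotopic.inv_arrow α.1
  | arrow_inv α => exact Homotopic.arrow_inv α.1
  | rel p q r hr hp hq =>
    rw [Q.mapWalk_ofPath, Q.mapWalk_ofPath]
    have key : ∀ s, (Q.mapAlg r).toFinsupp (Q.mapPath s) = r.toFinsupp s := fun s =>
      Finsupp.mapDomain_apply Q.mapPath_injective r.toFinsupp s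
    exact Homotopic.rel _ _ (Q.mapAlg r) (hr.map hI) ((key ⟨_, _, p⟩).trans_ne hp)
      ((key ⟨_, _, q⟩).trans_ne hq)

/-- Given a walk `γ` from `x₀` to a vertex `y` of a subquiver `Q'` of `Q`, the homomorphism
`π₁(Q', I', y) → π₁(Q, I, x₀)`, `[u] ↦ [γ⁻¹ u γ]`. -/
def Subquiver.pi1Map {Q : Subquiver V} {I' : TwoSidedIdeal (PathAlgebra k Q.Vert)}
    {I : TwoSidedIdeal (PathAlgebra k V)} (hI : Q.Compatible I' I) {x₀ : V} {y : Q.Vert}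
    (γ : Walk x₀ y.1) : Pi1 I' y →* Pi1 I x₀ where
  toFun := Quotient.map (fun u => (γ.comp (Q.mapWalk u)).comp γ.inv) fun _ _ h =>
    ((Homotopic.refl γ).comp (h.mapWalk hI)).comp (Homotopic.refl γ.inv)
  map_one' := Pi1.mk_eq I (Homotopic.comp_inv I γ)
  map_mul' := by
    rintro ⟨u⟩ ⟨w⟩
    refine Pi1.mk_eq I ?_
    have h : Homotopic I (((γ.comp (Q.mapWalk w)).comp γ.inv).comp
        (γ.comp ((Q.mapWalk u).comp γ.inv)))
        ((γ.comp (Q.mapWalk w)).comp ((Q.mapWalk u).comp γ.inv)) :=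
      Homotopic.cancel_mid I (Homotopic.inv_comp I γ)
    have e1 : (γ.comp (Q.mapWalk (w.comp u))).comp γ.inv =
        (γ.comp (Q.mapWalk w)).comp ((Q.mapWalk u).comp γ.inv) := by
      rw [Q.mapWalk_comp]
      simp only [Walk.comp_assoc]
    have e2 : ((γ.comp (Q.mapWalk w)).comp γ.inv).comp ((γ.comp (Q.mapWalk u)).comp γ.inv) =
        ((γ.comp (Q.mapWalk w)).comp γ.inv).comp (γ.comp ((Q.mapWalk u).comp γ.inv)) := by
      simp only [Walk.comp_assoc]
    change Homotopic I ((γ.comp (Q.mapWalk (w.comp u))).comp γ.inv)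
      (((γ.comp (Q.mapWalk w)).comp γ.inv).comp ((γ.comp (Q.mapWalk u)).comp γ.inv))
    rw [e1, e2]
    exact h.symm

open Classical in
/-- The homomorphism `π₁(Q', I')ᵃᵇ → π₁(Q, I, x₀)ᵃᵇ` induced by the inclusion of a subquiver `Q'`
of `Q`, where `γ` chooses a walk from the base point `x₀` to the base point of each connected
component of `Q'` (the result does not depend on `γ`). -/
def Subquiver.abMap {Q : Subquiver V} {I' : TwoSidedIdeal (PathAlgebra k Q.Vert)}
    {I : TwoSidedIdeal (PathAlgebra k V)} (hI : Q.Compatible I' I) {x₀ : V}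
    (γ : ∀ c : WeaklyConnectedComponent Q.Vert, Walk x₀ (componentBase c).1) :
    Abelianization (Pi1Prod I') →* Abelianization (Pi1 I x₀) :=
  haveI : Finite (WeaklyConnectedComponent Q.Vert) :=
    inferInstanceAs (Finite (Quotient (zigzagSetoid Q.Vert)))
  letI := Fintype.ofFinite (WeaklyConnectedComponent Q.Vert)
  Abelianization.lift (∏ c : WeaklyConnectedComponent Q.Vert,
    (Abelianization.of.comp (Subquiver.pi1Map hI (γ c))).comp
      (Pi.evalMonoidHom (fun c => Pi1 I' (componentBase c)) c))

/-! ### The contracted fundamental group -/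

/-- The classes `[v⁻¹ u'⁻¹ u v]`, with `u`, `u'` parallel walks in the subquiver and `v` a walk
starting at the base point. -/
def Subquiver.contractionGenerators (Q : Subquiver V) (I : TwoSidedIdeal (PathAlgebra k V))
    (x₀ : V) : Set (Pi1 I x₀) :=
  {g | ∃ (a b : Q.Vert) (u u' : Walk a b) (z : Walk x₀ a.1),
    g = Pi1.mk I (((z.comp (Q.mapWalk u)).comp (Q.mapWalk u').inv).comp z.inv)}

/-- The subgroup `N` of `π₁(Q, I, x₀)` generated by the classes `[v⁻¹ u'⁻¹ u v]`. -/
def Subquiver.contractionSubgroup (Q : Subquiver V) (I : TwoSidedIdeal (PathAlgebra k V))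
    (x₀ : V) : Subgroup (Pi1 I x₀) :=
  Subgroup.closure (Q.contractionGenerators I x₀)

instance (Q : Subquiver V) (I : TwoSidedIdeal (PathAlgebra k V)) (x₀ : V) :
    (Q.contractionSubgroup I x₀).Normal where
  conj_mem := by
    intro n hn g
    induction hn using Subgroup.closure_induction with
    | mem n hn =>
      obtain ⟨a, b, u, u', z, rfl⟩ := hn
      induction g using Quotient.inductionOn with
      | _ g =>
      refine Subgroup.subset_closure ⟨a, b, u, u', g.inv.comp z, ?_⟩
      change Pi1.mk I (g.inv.comp _) = _
      refine congrArg (Pi1.mk I) ?_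
      simp only [Walk.inv_comp, Walk.inv_inv, Walk.comp_assoc]
    | one => simp
    | mul x y _ _ hx hy =>
      have := mul_mem hx hy
      simpa [mul_assoc] using this
    | inv x _ hx =>
      have := inv_mem hx
      simpa [mul_assoc] using this

/-- The contracted fundamental group `π₁(Q, I, x₀) / N` relative to a subquiver. -/
abbrev Subquiver.ContractedPi1 (Q : Subquiver V) (I : TwoSidedIdeal (PathAlgebra k V))
    (x₀ : V) : Type (max u v) :=
  Pi1 I x₀ ⧸ Q.contractionSubgroup I x₀

/-! ### Trees and the quiver `Q_{A|B,T}` -/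

/-- A vertex, seen as a vertex of a wide subquiver. -/
def toWide (W : WideSubquiver V) (a : V) : W := a

/-- Two vertices are joined by a walk that uses only the arrows in `W`. -/
def Joined (W : WideSubquiver V) (a b : V) : Prop := Nonempty (Walk (toWide W a) (toWide W b))

/-- The set `W` of arrows without the arrow `α`. -/
def deleteArrow (W : WideSubquiver V) (α : Total V) : WideSubquiver V :=
  fun a b => {β | β ∈ W a b ∧ Total.mk a b β ≠ α}

/-- A set of arrows is a forest (its underlying graph has no cycles): no arrow of it joins two
vertices that are already joined by a walk through the other arrows. -/
def IsForest (W : WideSubquiver V) : Prop :=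
  ∀ (a b : V) (α : a ⟶ b), α ∈ W a b → ¬ Joined (deleteArrow W ⟨a, b, α⟩) a b

/-- `F` is a maximal forest of `W`: a forest in `W` that restricts to a maximal (spanning)
tree of each connected component of `W`. -/
def IsMaximalForest (F W : WideSubquiver V) : Prop :=
  (∀ a b, F a b ⊆ W a b) ∧ IsForest F ∧ ∀ a b, Joined W a b → Joined F a b

/-- The arrows of `T` that lie in the subquiver. -/
def Subquiver.treePart (Q : Subquiver V) (T : WideSubquiver V) : WideSubquiver V :=
  fun a b => T a b ∩ Q.arrows a b

/-- `T` is an extended maximal tree: a maximal tree of the whole quiver (which is connected)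
extending a maximal forest of the subquiver. -/
def Subquiver.IsExtendedMaximalTree (Q : Subquiver V) (T : WideSubquiver V) : Prop :=
  IsForest T ∧ (∀ a b, Joined T a b) ∧
    IsMaximalForest (Q.treePart T) Q.arrows

/-- The quiver `Q_{A|B,T}`: all vertices, and the arrows that are not in the subquiver
or are in `T`. -/
def Subquiver.relQuiver (Q : Subquiver V) (T : WideSubquiver V) : WideSubquiver V :=
  fun a b => (Q.arrows a b)ᶜ ∪ T a b

/-- The fundamental group of the quiver `Q_{A|B,T}` (with no relations). -/
abbrev Subquiver.RelPi1 (k : Type w) [Field k] (Q : Subquiver V) (T : WideSubquiver V) (x₀ : V) :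
    Type (max u v) :=
  Pi1 (⊥ : TwoSidedIdeal (PathAlgebra k (Q.relQuiver T))) (toWide (Q.relQuiver T) x₀)

end Subquiver

end QuiverAlg

end

open QuiverAlg

/-! The theorem reduces to the first homology of graphs. In a monomial ideal every path occurring in
an element already belongs to the ideal, so a minimal relation involves a single path
(`IsMonomialIdeal.eq_of_isMinimalRelation`) and imposes nothing on walks. Counting signed passages
through arrows is therefore invariant under homotopy (`Homotopic.chain_eq`), and it identifies the
abelianized fundamental group with the group of cycles, the kernel of the boundary map on arrows
(`abChain_injective`, `mem_range_abChain`, and `prodChain_injective`, `mem_range_prodChain` for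
several components). This group is free of rank `betti` (`finrank_cycles`).

On cycles, the inclusion of `Q_B` is extension by zero, hence injective, and the contraction
subgroup has the cycles of `Q_B` as its image. The geometric core is that the cycles of `Q_A` are
the direct sum of those of `Q_{A|B,T}` and those of `Q_B`. Replacing each arrow of `Q_B` by a walk
in the forest `T ∩ Q_B` decomposes any cycle (`Subquiver.exists_cycle_decomposition`). A cycle lying
in both summands is supported on the tree `T`, so it vanishes (`IsForest.eq_zero`). The Betti number
formula and the isomorphisms follow.

For the `π₁`-rank, a monomial presentation gives a dual of dimension `betti`. Any admissible
presentation gives at most the Betti number of its own quiver, because adding relations passes to a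
quotient group (`rank_dualGroup_pi1Prod_le`). That Betti number depends only on the algebra
(`IsAdmissiblePresentation.betti_eq`): with `R` the span of the nilpotents, the dimensions of
`A/R²`, of `A/R` and of the image of the center in `A/R` count vertices plus arrows, vertices, and
components. So monomial presentations attain the maximum, and the rank formula is the Betti formula
again. -/

noncomputable section

namespace QuiverAlg

/-! ### Chains of walks and cycles of a quiver -/

section Chains

variable {V : Type u} [Quiver.{v} V]

/-- The 1-chain of an arrow or of a formal inverse of an arrow. -/
def stepChain {a b : V} : (a ⟶ b) ⊕ (b ⟶ a) → (Total V →₀ ℤ)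
  | Sum.inl α => Finsupp.single ⟨a, b, α⟩ 1
  | Sum.inr α => Finsupp.single ⟨b, a, α⟩ (-1)

/-- The 1-chain of a walk: the signed number of its passages through each arrow. -/
def Walk.chain {a b : V} (u : Walk a b) : Total V →₀ ℤ :=
  @Quiver.Path.rec (Symmetrify V) _ a (fun _ _ => Total V →₀ ℤ) 0
    (fun _ e z => z + stepChain e) b u

theorem Walk.chain_nil (a : V) : (Walk.nil a).chain = 0 := rfl

theorem Walk.chain_arrow {a b : V} (α : a ⟶ b) :
    (Walk.arrow α).chain = Finsupp.single ⟨a, b, α⟩ 1 := zero_add _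

theorem Walk.chain_invArrow {a b : V} (α : a ⟶ b) :
    (Walk.invArrow α).chain = Finsupp.single ⟨a, b, α⟩ (-1) := zero_add _

theorem Walk.chain_comp_arrow {a b c : V} (u : Walk a b) (α : b ⟶ c) :
    (u.comp (Walk.arrow α)).chain = u.chain + Finsupp.single ⟨b, c, α⟩ 1 := rfl

theorem Walk.chain_comp_invArrow {a b c : V} (u : Walk a b) (α : c ⟶ b) :
    (u.comp (Walk.invArrow α)).chain = u.chain + Finsupp.single ⟨c, b, α⟩ (-1) := rfl

theorem Walk.chain_comp {a b c : V} (u : Walk a b) (w : Walk b c) :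
    (u.comp w).chain = u.chain + w.chain := by
  induction w using Walk.induction with
  | nil => rw [Walk.comp_nil, Walk.chain_nil, add_zero]
  | arrow w α ih =>
    rw [← Walk.comp_assoc, Walk.chain_comp_arrow, ih, Walk.chain_comp_arrow, add_assoc]
  | invArrow w α ih =>
    rw [← Walk.comp_assoc, Walk.chain_comp_invArrow, ih, Walk.chain_comp_invArrow, add_assoc]

theorem Walk.chain_inv {a b : V} (u : Walk a b) : u.inv.chain = -u.chain := by
  induction u using Walk.induction with
  | nil => rw [Walk.inv_nil, Walk.chain_nil, neg_zero]
  | arrow u α ih =>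
    rw [Walk.inv_comp, Walk.chain_comp, ih, Walk.inv_arrow, Walk.chain_invArrow,
      Walk.chain_comp_arrow, neg_add_rev, Finsupp.single_neg]
  | invArrow u α ih =>
    rw [Walk.inv_comp, Walk.chain_comp, ih, Walk.inv_invArrow, Walk.chain_arrow,
      Walk.chain_comp_invArrow, neg_add_rev, Finsupp.single_neg, neg_neg]

/-- The boundary map `α ↦ t(α) - s(α)`. -/
def boundary (V : Type u) [Quiver.{v} V] : (Total V →₀ ℤ) →ₗ[ℤ] (V →₀ ℤ) :=
  Finsupp.lmapDomain ℤ ℤ Total.right - Finsupp.lmapDomain ℤ ℤ Total.left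

theorem boundary_single (α : Total V) (n : ℤ) :
    boundary V (Finsupp.single α n) = Finsupp.single α.right n - Finsupp.single α.left n := by
  simp [boundary]

theorem boundary_chain {a b : V} (u : Walk a b) :
    boundary V u.chain = Finsupp.single b 1 - Finsupp.single a 1 := by
  induction u using Walk.induction with
  | nil => rw [Walk.chain_nil, map_zero, sub_self]
  | arrow u α ih => rw [Walk.chain_comp_arrow, map_add, ih, boundary_single]; abel
  | invArrow u α ih =>
    rw [Walk.chain_comp_invArrow, map_add, ih, boundary_single]
    simp only [Finsupp.single_neg]
    abel

/-- The group of cycles of a quiver. -/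
def cycles (V : Type u) [Quiver.{v} V] : Submodule ℤ (Total V →₀ ℤ) := LinearMap.ker (boundary V)

theorem mem_cycles {z : Total V →₀ ℤ} : z ∈ cycles V ↔ boundary V z = 0 := Iff.rfl

theorem Walk.chain_mem_cycles {a : V} (u : Walk a a) : u.chain ∈ cycles V := by
  rw [mem_cycles, boundary_chain, sub_self]

/-- The pairing of a vertex function with a boundary. -/
theorem linearCombination_boundary (f : V → ℤ) (z : Total V →₀ ℤ) :
    Finsupp.linearCombination ℤ f (boundary V z) =
      Finsupp.linearCombination ℤ (fun α : Total V => f α.right - f α.left) z := by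
  induction z using Finsupp.induction_linear with
  | zero => simp
  | add x y hx hy => rw [map_add, map_add, hx, hy, map_add]
  | single α n => simp [boundary_single, mul_sub]

/-- The map on arrows induced by a prefunctor. -/
def mapTotal {U : Type u} [Quiver.{v} U] (F : U ⥤q V) (α : Total U) : Total V :=
  ⟨F.obj α.left, F.obj α.right, F.map α.hom⟩

/-! ### Functoriality of walks, chains and cycles. -/

section Map

variable {U : Type u} [Quiver.{v} U] (F : U ⥤q V)

/-- The map on walks induced by a prefunctor. -/
def Walk.map {a b : U} (w : Walk a b) : Walk (F.obj a) (F.obj b) := F.symmetrify.mapPath w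

theorem Walk.map_comp {a b c : U} (w : Walk a b) (z : Walk b c) :
    (w.comp z).map F = (w.map F).comp (z.map F) := F.symmetrify.mapPath_comp w z

theorem Walk.chain_map {a b : U} (w : Walk a b) :
    (w.map F).chain = w.chain.mapDomain (mapTotal F) := by
  induction w using Walk.induction with
  | nil => exact Finsupp.mapDomain_zero.symm
  | arrow u α ih =>
    rw [Walk.map_comp, Walk.chain_comp, ih, Walk.chain_comp_arrow, Finsupp.mapDomain_add,
      Finsupp.mapDomain_single]
    exact congrArg (_ + ·) (Walk.chain_arrow (F.map α))
  | invArrow u α ih =>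
    rw [Walk.map_comp, Walk.chain_comp, ih, Walk.chain_comp_invArrow,
      Finsupp.mapDomain_add, Finsupp.mapDomain_single]
    exact congrArg (_ + ·) (Walk.chain_invArrow (F.map α))

theorem boundary_mapDomain (z : Total U →₀ ℤ) :
    boundary V (z.mapDomain (mapTotal F)) = (boundary U z).mapDomain F.obj := by
  induction z using Finsupp.induction_linear with
  | zero => simp
  | add x y hx hy => rw [Finsupp.mapDomain_add, map_add, hx, hy, map_add, Finsupp.mapDomain_add]
  | single α n =>
    rw [Finsupp.mapDomain_single, boundary_single, boundary_single, sub_eq_add_neg,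
      sub_eq_add_neg, ← Finsupp.single_neg, ← Finsupp.single_neg, Finsupp.mapDomain_add,
      Finsupp.mapDomain_single, Finsupp.mapDomain_single]
    rfl

theorem mapDomain_mem_cycles {z : Total U →₀ ℤ} (hz : z ∈ cycles U) :
    z.mapDomain (mapTotal F) ∈ cycles V := by
  rw [mem_cycles, boundary_mapDomain, mem_cycles.1 hz, Finsupp.mapDomain_zero]

/-- Injectivity on vertices is enough: the boundary commutes with pushing forward, and only the
resulting 0-chain has to be pulled back. -/
theorem mem_cycles_of_mapDomain (hF : Function.Injective F.obj) {z : Total U →₀ ℤ}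
    (hz : z.mapDomain (mapTotal F) ∈ cycles V) : z ∈ cycles U := by
  rw [mem_cycles, boundary_mapDomain] at hz
  exact Finsupp.mapDomain_injective hF (hz.trans Finsupp.mapDomain_zero.symm)

end Map

/-- The inclusion of a wide subquiver. -/
def wideIncl (W : WideSubquiver V) : W ⥤q V where
  obj a := a
  map α := α.1

theorem mapTotal_wideIncl_injective (W : WideSubquiver V) :
    Function.Injective (mapTotal (wideIncl W)) := by
  rintro ⟨a, b, α⟩ ⟨a', b', α'⟩ h
  obtain ⟨h1, h2, h3⟩ := Total.mk.inj h
  change a = a' at h1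
  change b = b' at h2
  subst h1 h2
  obtain rfl : α = α' := Subtype.ext (eq_of_heq h3)
  rfl

theorem range_mapTotal_wideIncl (W : WideSubquiver V) :
    Set.range (mapTotal (wideIncl W)) = {α | α.hom ∈ W α.left α.right} := by
  ext ⟨a, b, α⟩
  constructor
  · rintro ⟨⟨a', b', α'⟩, h⟩
    rw [← h]
    exact α'.2
  · intro h
    exact ⟨⟨a, b, ⟨α, h⟩⟩, rfl⟩

theorem Subquiver.mapTotal_incl_injective (Q : Subquiver V) :
    Function.Injective (mapTotal Q.incl) := by
  rintro ⟨⟨a, ha⟩, ⟨b, hb⟩, α⟩ ⟨⟨a', ha'⟩, ⟨b', hb'⟩, α'⟩ h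
  obtain ⟨h1, h2, h3⟩ := Total.mk.inj h
  change a = a' at h1
  change b = b' at h2
  subst h1 h2
  obtain rfl : α = α' := Subtype.ext (eq_of_heq h3)
  rfl

theorem Subquiver.range_mapTotal_incl (Q : Subquiver V) :
    Set.range (mapTotal Q.incl) = {α | α.hom ∈ Q.arrows α.left α.right} := by
  ext ⟨a, b, α⟩
  constructor
  · rintro ⟨⟨a', b', α'⟩, h⟩
    rw [← h]
    exact α'.2
  · intro h
    exact ⟨⟨⟨a, Q.source_mem h⟩, ⟨b, Q.target_mem h⟩, ⟨α, h⟩⟩, rfl⟩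

theorem exists_mapDomain_eq {X Y : Type*} {f : X → Y} (z : Y →₀ ℤ)
    (hz : ∀ y ∈ z.support, y ∈ Set.range f) : ∃ x : X →₀ ℤ, x.mapDomain f = z := by
  have h : z ∈ Finsupp.supported ℤ ℤ (f '' Set.univ) := by
    rw [Set.image_univ]
    exact fun y hy => hz y hy
  rw [← Finsupp.lmapDomain_supported] at h
  obtain ⟨x, -, hx⟩ := h
  exact ⟨x, hx⟩

/-- A walk in a wide subquiver passes only through its arrows. -/
theorem chain_wide_support {W : WideSubquiver V} {a b : W} (u : Walk a b) (α : Total V)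
    (hα : α ∈ (u.map (wideIncl W)).chain.support) : α.hom ∈ W α.left α.right := by
  classical
  rw [Walk.chain_map] at hα
  obtain ⟨β, -, rfl⟩ := Finset.mem_image.1 (Finsupp.mapDomain_support hα)
  exact β.hom.2

/-- Cycles that only involve the arrows of a forest vanish. -/
theorem IsForest.eq_zero {W : WideSubquiver V} (hW : IsForest W) {z : Total V →₀ ℤ}
    (hz : z ∈ cycles V) (hs : ∀ α ∈ z.support, α.hom ∈ W α.left α.right) : z = 0 := by
  classical
  ext α
  by_contra h0
  have hα : α ∈ z.support := Finsupp.mem_support_iff.2 h0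
  -- The indicator of the component of the source of `α` once `α` is removed. It agrees at both ends
  -- of every other arrow in the support of `z`, while the forest condition separates the ends of
  -- `α`; pairing it with the zero boundary of `z` leaves only `-z α`.
  let f : V → ℤ := fun v => if Joined (deleteArrow W α) α.left v then 1 else 0
  have h1 : Finsupp.linearCombination ℤ f (boundary V z) = 0 := by rw [mem_cycles.1 hz, map_zero]
  rw [linearCombination_boundary, Finsupp.linearCombination_apply, Finsupp.sum,
    Finset.sum_eq_single α] at h1
  · have hl : f α.left = 1 := if_pos ⟨Walk.nil (V := deleteArrow W α) _⟩
    have hr : f α.right = 0 := if_neg (hW _ _ _ (hs α hα))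
    rw [hl, hr] at h1
    apply h0
    simpa using h1
  · intro β hβ hne
    have : f β.right = f β.left := by
      let e : toWide (deleteArrow W α) β.left ⟶ toWide (deleteArrow W α) β.right :=
        ⟨β.hom, hs β hβ, hne⟩
      have : Joined (deleteArrow W α) α.left β.right ↔ Joined (deleteArrow W α) α.left β.left :=
        ⟨fun ⟨p⟩ => ⟨p.comp (Walk.invArrow e)⟩, fun ⟨p⟩ => ⟨p.comp (Walk.arrow e)⟩⟩
      simp only [f, this]
    rw [this, sub_self, smul_zero]
  · exact fun h => absurd hα h

end Chains

/-! ### The Betti number as the rank of the group of cycles -/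

section Betti

variable {V : Type u} [Quiver.{v} V]

theorem component_eq_of_arrow {a b : V} (α : a ⟶ b) :
    WeaklyConnectedComponent.mk a = WeaklyConnectedComponent.mk b :=
  (WeaklyConnectedComponent.eq a b).2 ⟨Walk.arrow α⟩

theorem component_componentBase (c : WeaklyConnectedComponent V) :
    WeaklyConnectedComponent.mk (componentBase c) = c := Quotient.out_eq (s := zigzagSetoid V) c

/-- A walk from the chosen vertex of its connected component to a vertex. -/
def walkFromBase (c : WeaklyConnectedComponent V) (b : V) (h : WeaklyConnectedComponent.mk b = c) :
    Walk (componentBase c) b :=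
  ((WeaklyConnectedComponent.eq (componentBase c) b).1
    ((component_componentBase c).trans h.symm)).some

instance [Finite V] : Finite (WeaklyConnectedComponent V) :=
  inferInstanceAs (Finite (Quotient (zigzagSetoid V)))

instance finite_total [Finite V] [∀ a b : V, Finite (a ⟶ b)] : Finite (Total V) :=
  Finite.of_surjective (fun x : Σ a b : V, (a ⟶ b) => (⟨x.1, x.2.1, x.2.2⟩ : Total V))
    fun α => ⟨⟨α.left, α.right, α.hom⟩, rfl⟩

/-- Moving each vertex to the base vertex of its component along a chosen walk changes a 0-chain by
a boundary. What remains records the coefficient sums over the components, so nothing remains if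
these are zero. -/
theorem range_boundary : LinearMap.range (boundary V) =
    LinearMap.ker (Finsupp.lmapDomain ℤ ℤ (WeaklyConnectedComponent.mk (V := V))) := by
  apply le_antisymm
  · rintro _ ⟨z, rfl⟩
    rw [LinearMap.mem_ker]
    induction z using Finsupp.induction_linear with
    | zero => simp
    | add x y hx hy => rw [map_add, map_add, hx, hy, add_zero]
    | single α n =>
      rw [boundary_single, map_sub, Finsupp.lmapDomain_apply, Finsupp.lmapDomain_apply,
        Finsupp.mapDomain_single, Finsupp.mapDomain_single, component_eq_of_arrow α.hom, sub_self]
  · intro f hf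
    have key : ∀ f : V →₀ ℤ, f - (f.mapDomain WeaklyConnectedComponent.mk).mapDomain componentBase
        ∈ LinearMap.range (boundary V) := by
      intro f
      induction f using Finsupp.induction_linear with
      | zero => simp
      | add x y hx hy =>
        rw [Finsupp.mapDomain_add, Finsupp.mapDomain_add, add_sub_add_comm]
        exact add_mem hx hy
      | single a n =>
        rw [Finsupp.mapDomain_single, Finsupp.mapDomain_single]
        refine ⟨n • (walkFromBase _ a rfl).chain, ?_⟩
        rw [map_smul, boundary_chain, smul_sub, Finsupp.smul_single, Finsupp.smul_single,
          smul_eq_mul, mul_one]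
    have h := key f
    rw [LinearMap.mem_ker, Finsupp.lmapDomain_apply] at hf
    rwa [hf, Finsupp.mapDomain_zero, sub_zero] at h

theorem finrank_range_add_finrank_ker_int {M N : Type*} [AddCommGroup M] [AddCommGroup N]
    [Module.Finite ℤ M] (f : M →ₗ[ℤ] N) :
    Module.finrank ℤ (LinearMap.range f) + Module.finrank ℤ (LinearMap.ker f) =
      Module.finrank ℤ M := by
  rw [← f.quotKerEquivRange.finrank_eq, Submodule.finrank_quotient_add_finrank]

/-- Rank-nullity twice: by `range_boundary` the boundaries have rank `n - c`, which leaves `m - (n -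
c)` for the cycles. -/
theorem finrank_cycles [Finite V] [∀ a b : V, Finite (a ⟶ b)] :
    (Module.finrank ℤ (cycles V) : ℤ) = betti V := by
  have := Fintype.ofFinite V
  have := Fintype.ofFinite (Total V)
  have := Fintype.ofFinite (WeaklyConnectedComponent V)
  have h1 := finrank_range_add_finrank_ker_int (boundary V)
  have h2 := finrank_range_add_finrank_ker_int
    (Finsupp.lmapDomain ℤ ℤ (WeaklyConnectedComponent.mk (V := V)))
  have h3 : LinearMap.range (Finsupp.lmapDomain ℤ ℤ (WeaklyConnectedComponent.mk (V := V))) = ⊤ :=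
    LinearMap.range_eq_top.2 (Finsupp.mapDomain_surjective fun c =>
      ⟨componentBase c, component_componentBase c⟩)
  rw [h3, finrank_top, ← range_boundary] at h2
  rw [Module.finrank_finsupp_self] at h1
  rw [Module.finrank_finsupp_self, Module.finrank_finsupp_self] at h2
  rw [betti, Nat.card_eq_fintype_card, Nat.card_eq_fintype_card, Nat.card_eq_fintype_card]
  change _ + Module.finrank ℤ (cycles V) = _ at h1
  lia

end Betti

/-! ### Minimal relations of monomial ideals -/

section Monomial

variable {k : Type w} {V : Type u} [Field k] [Quiver.{v} V] [Fintype V]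

theorem smul_mem_ideal {I : TwoSidedIdeal (PathAlgebra k V)} (c : k) {x : PathAlgebra k V}
    (hx : x ∈ I) : c • x ∈ I := by
  rw [← one_mul x, ← PathAlgebra.smul_mul']
  exact I.mul_mem_left _ _ hx

theorem PathAlgebra.toFinsupp_path {k : Type w} {V : Type u} [Field k] [Quiver.{v} V] (p : AnyPath V) :
    (PathAlgebra.path k p).toFinsupp = Finsupp.single p 1 := rfl

/-- The span of the paths in an ideal. -/
def pathSpan (I : TwoSidedIdeal (PathAlgebra k V)) : Submodule k (PathAlgebra k V) :=
  Submodule.span k (PathAlgebra.path k '' {p | PathAlgebra.path k p ∈ I})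

/-- A product of two paths is a path or zero. This is what makes `pathSpan I` stable under
multiplication from both sides. -/
theorem mulPath_mem_pathSpan {I : TwoSidedIdeal (PathAlgebra k V)} {p q : AnyPath V}
    (h : PathAlgebra.path k p * PathAlgebra.path k q ∈ I) :
    PathAlgebra.path k p * PathAlgebra.path k q ∈ pathSpan I := by
  rw [PathAlgebra.path_mul_path] at h ⊢
  unfold PathAlgebra.mulPath at h ⊢
  split_ifs at h ⊢
  · exact Submodule.subset_span ⟨_, h, rfl⟩
  · exact zero_mem _

theorem mul_mem_pathSpan_left {I : TwoSidedIdeal (PathAlgebra k V)} (x : PathAlgebra k V)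
    {y : PathAlgebra k V} (hy : y ∈ pathSpan I) : x * y ∈ pathSpan I := by
  induction x using PathAlgebra.induction with
  | zero => rw [zero_mul]; exact zero_mem _
  | add x x' hx hx' => rw [add_mul]; exact add_mem hx hx'
  | smul c p =>
    rw [PathAlgebra.smul_mul']
    refine Submodule.smul_mem _ _ ?_
    induction hy using Submodule.span_induction with
    | mem y hy =>
      obtain ⟨q, hq, rfl⟩ := hy
      exact mulPath_mem_pathSpan (I.mul_mem_left _ _ hq)
    | zero => rw [mul_zero]; exact zero_mem _
    | add y y' _ _ h h' => rw [mul_add]; exact add_mem h h'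
    | smul c y _ h => rw [PathAlgebra.mul_smul']; exact Submodule.smul_mem _ _ h

theorem mul_mem_pathSpan_right {I : TwoSidedIdeal (PathAlgebra k V)} {y : PathAlgebra k V}
    (x : PathAlgebra k V) (hy : y ∈ pathSpan I) : y * x ∈ pathSpan I := by
  induction x using PathAlgebra.induction with
  | zero => rw [mul_zero]; exact zero_mem _
  | add x x' hx hx' => rw [mul_add]; exact add_mem hx hx'
  | smul c p =>
    rw [PathAlgebra.mul_smul']
    refine Submodule.smul_mem _ _ ?_
    induction hy using Submodule.span_induction with
    | mem y hy =>
      obtain ⟨q, hq, rfl⟩ := hy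
      exact mulPath_mem_pathSpan (I.mul_mem_right _ _ hq)
    | zero => rw [zero_mul]; exact zero_mem _
    | add y y' _ _ h h' => rw [add_mul]; exact add_mem h h'
    | smul c y _ h => rw [PathAlgebra.smul_mul']; exact Submodule.smul_mem _ _ h

/-- `pathSpan I` is itself a two-sided ideal and contains the generating paths of `I`. -/
theorem IsMonomialIdeal.mem_pathSpan {I : TwoSidedIdeal (PathAlgebra k V)}
    (hI : IsMonomialIdeal I) {x : PathAlgebra k V} (hx : x ∈ I) : x ∈ pathSpan I := by
  obtain ⟨Z, -, hZ⟩ := hI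
  let K : TwoSidedIdeal (PathAlgebra k V) := TwoSidedIdeal.mk' (pathSpan I : Set (PathAlgebra k V))
    (zero_mem _) (fun h h' => add_mem h h') (fun h => neg_mem h)
    (fun h => mul_mem_pathSpan_left _ h) (fun h => mul_mem_pathSpan_right _ h)
  have hK : I ≤ K := by
    conv_lhs => rw [hZ]
    rw [TwoSidedIdeal.span_le]
    rintro _ ⟨p, hp, rfl⟩
    have hp' : PathAlgebra.path k p ∈ I := by
      rw [hZ]
      exact TwoSidedIdeal.subset_span ⟨p, hp, rfl⟩
    exact (TwoSidedIdeal.mem_mk' ..).2 (Submodule.subset_span ⟨p, hp', rfl⟩)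
  exact (TwoSidedIdeal.mem_mk' ..).1 (hK hx)

/-- The paths in the elements of a monomial ideal belong to the ideal. -/
theorem IsMonomialIdeal.path_mem {I : TwoSidedIdeal (PathAlgebra k V)} (hI : IsMonomialIdeal I)
    {x : PathAlgebra k V} (hx : x ∈ I) (p : AnyPath V) (hp : x.toFinsupp p ≠ 0) :
    PathAlgebra.path k p ∈ I := by
  classical
  have h := hI.mem_pathSpan hx
  induction h using Submodule.span_induction with
  | mem y hy =>
    obtain ⟨q, hq, rfl⟩ := hy
    rw [PathAlgebra.toFinsupp_path, Finsupp.single_apply] at hp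
    split_ifs at hp with h
    · exact h ▸ hq
    · exact absurd rfl hp
  | zero => exact absurd rfl hp
  | add y z hy hz ihy ihz =>
    have hmem : ∀ x ∈ pathSpan I, x ∈ I := fun x hx => by
      induction hx using Submodule.span_induction with
      | mem y hy => obtain ⟨q, hq, rfl⟩ := hy; exact hq
      | zero => exact zero_mem _
      | add y z _ _ h h' => exact add_mem h h'
      | smul c y _ h => exact smul_mem_ideal c h
    by_cases h0 : y.toFinsupp p = 0
    · refine ihz (hmem z hz) fun h1 => hp ?_
      change y.toFinsupp p + z.toFinsupp p = 0
      rw [h0, h1, add_zero]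
    · exact ihy (hmem y hy) h0
  | smul c y hy ih =>
    have hc : c ≠ 0 := by
      rintro rfl
      apply hp
      change 0 * y.toFinsupp p = 0
      rw [zero_mul]
    refine ih ?_ fun h1 => hp ?_
    · have := smul_mem_ideal c⁻¹ hx
      rwa [inv_smul_smul₀ hc] at this
    · change c * y.toFinsupp p = 0
      rw [h1, mul_zero]

/-- A minimal relation of a monomial ideal involves only one path. -/
theorem IsMonomialIdeal.eq_of_isMinimalRelation {I : TwoSidedIdeal (PathAlgebra k V)}
    (hI : IsMonomialIdeal I) {r : PathAlgebra k V} (hr : IsMinimalRelation I r) {p q : AnyPath V}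
    (hp : r.toFinsupp p ≠ 0) (hq : r.toFinsupp q ≠ 0) : q = p := by
  classical
  obtain ⟨h1, -, h3⟩ := hr
  -- Minimality is tested on the one-term subsum at `p`: it lies in `I` and is non-zero at `p`, so
  -- it must be all of `r`.
  have hf : r.toFinsupp.filter (· ∈ ({p} : Set (AnyPath V))) =
      r.toFinsupp p • Finsupp.single p 1 := by
    ext s
    rw [Finsupp.filter_apply, Finsupp.smul_apply, Finsupp.single_apply, smul_eq_mul]
    by_cases hs : s = p
    · subst hs
      simp
    · rw [if_neg (show s ∉ ({p} : Set (AnyPath V)) from hs), if_neg (Ne.symm hs), mul_zero]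
  have hmem : PathAlgebra.ofFinsupp (r.toFinsupp.filter (· ∈ ({p} : Set (AnyPath V)))) ∈ I := by
    rw [hf]
    exact smul_mem_ideal _ (hI.path_mem h1 p hp)
  have := h3 {p} (by convert hmem)
  by_contra hne
  rcases this with h | h
  · have := DFunLike.congr_fun h p
    rw [Finsupp.filter_apply, if_pos (Set.mem_singleton p)] at this
    exact hp this
  · have := DFunLike.congr_fun h q
    rw [Finsupp.filter_apply, if_neg (show q ∉ ({p} : Set (AnyPath V)) from hne)] at this
    exact hq this.symm

/-- Brings quivers without relations, in particular `Q_{A|B,T}`, under the results on monomial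
ideals. -/
theorem isMonomialIdeal_bot : IsMonomialIdeal (⊥ : TwoSidedIdeal (PathAlgebra k V)) := by
  refine ⟨∅, fun p hp => hp.elim, ?_⟩
  rw [Set.image_empty, eq_comm, eq_bot_iff, TwoSidedIdeal.span_le]
  exact Set.empty_subset _

/-- A minimal relation of a monomial ideal only identifies a path with itself. The remaining
generators cancel an arrow against its inverse, and these contribute opposite signs. -/
theorem Homotopic.chain_eq {I : TwoSidedIdeal (PathAlgebra k V)} (hI : IsMonomialIdeal I)
    {a b : V} {u w : Walk a b} (h : Homotopic I u w) : u.chain = w.chain := by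
  induction h with
  | refl u => rfl
  | symm _ ih => exact ih.symm
  | trans _ _ ih ih' => exact ih.trans ih'
  | comp _ _ ih ih' => rw [Walk.chain_comp, Walk.chain_comp, ih, ih']
  | inv_arrow α =>
    rw [Walk.chain_comp, ← Walk.inv_arrow, Walk.chain_inv, add_neg_cancel, Walk.chain_nil]
  | arrow_inv α =>
    rw [Walk.chain_comp, ← Walk.inv_arrow, Walk.chain_inv, neg_add_cancel, Walk.chain_nil]
  | rel p q r hr hp hq =>
    have h := hI.eq_of_isMinimalRelation hr hp hq
    have h4 : q = p := eq_of_heq (Sigma.mk.inj (eq_of_heq (Sigma.mk.inj h).2)).2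
    rw [h4]

end Monomial

/-! ### The abelianized fundamental group and cycles -/

section AbelianizedPi1

variable {k : Type w} {V : Type u} [Field k] [Quiver.{v} V] [Fintype V]
  {I : TwoSidedIdeal (PathAlgebra k V)}

/-- The homomorphism that maps the class of a closed walk to its chain. -/
def Pi1.chainHom (hI : IsMonomialIdeal I) (x : V) : Pi1 I x →* Multiplicative (Total V →₀ ℤ) where
  toFun := Quotient.lift (fun u => Multiplicative.ofAdd u.chain)
    fun _ _ h => congrArg _ (Homotopic.chain_eq hI h)
  map_one' := rfl
  map_mul' := by
    rintro ⟨u⟩ ⟨w⟩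
    exact congrArg Multiplicative.ofAdd ((Walk.chain_comp w u).trans (add_comm _ _))

theorem Pi1.chainHom_mk (hI : IsMonomialIdeal I) {x : V} (u : Walk x x) :
    Pi1.chainHom hI x (Pi1.mk I u) = Multiplicative.ofAdd u.chain := rfl

theorem exists_abelianization_of {G : Type*} [Group G] (g : Abelianization G) :
    ∃ h, Abelianization.of h = g := QuotientGroup.mk_surjective g

theorem Pi1.exists_mk {x : V} (g : Pi1 I x) : ∃ u, g = Pi1.mk I u := by
  obtain ⟨u⟩ := g
  exact ⟨u, rfl⟩

/-- Homomorphisms from the fundamental groups of the components of a bound quiver to an abelian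
group factor through chains. -/
theorem exists_factor_chain {C : Type*} {comp : V → C}
    (hcomp : ∀ {a b : V}, (a ⟶ b) → comp a = comp b) {base : C → V}
    (hbase : ∀ c, comp (base c) = c) (t : ∀ c b, comp b = c → Walk (base c) b)
    {M : Type*} [AddCommGroup M]
    (φ : ∀ c, Pi1 I (base c) →* Multiplicative M) :
    ∃ Θ : (Total V →₀ ℤ) →ₗ[ℤ] M, ∀ c (u : Walk (base c) (base c)),
      (φ c (Pi1.mk I u)).toAdd = Θ u.chain := by
  let ψ : ∀ c, Walk (base c) (base c) → M := fun c u => (φ c (Pi1.mk I u)).toAdd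
  have ψ_comp : ∀ c u w, ψ c (u.comp w) = ψ c u + ψ c w := fun c u w => by
    change (φ c (Pi1.mk I w * Pi1.mk I u)).toAdd = _
    rw [map_mul, toAdd_mul, add_comm]
  have ψ_eq : ∀ c u w, Homotopic I u w → ψ c u = ψ c w := fun c u w h => by
    simp only [ψ, Pi1.mk_eq I h]
  have ψ_mid : ∀ c {b d : V} (u : Walk (base c) b) (w : Walk b (base c)) (s : Walk (base c) b),
      ψ c (u.comp w) = ψ c (u.comp s.inv) + ψ c (s.comp w) := fun c b d u w s => by
    rw [← ψ_comp]
    exact ψ_eq _ _ _ (Homotopic.cancel_mid I (Homotopic.inv_comp I s)).symm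
  -- An arrow is evaluated on the loop that reaches its source by the chosen walk, crosses it, and
  -- returns from its target by the chosen walk.
  let θ : Total V → M := fun α => ψ (comp α.left)
    (((t _ α.left rfl).comp (Walk.arrow α.hom)).comp (t _ α.right (hcomp α.hom).symm).inv)
  have θ_eq : ∀ {c} {a b : V} (α : a ⟶ b) (ha : comp a = c) (hb : comp b = c),
      ψ c ((t c a ha).comp ((Walk.arrow α).comp (t c b hb).inv)) = θ ⟨a, b, α⟩ := by
    intro c a b α ha hb
    subst ha
    simp only [θ, Walk.comp_assoc]
  have ψ_nil : ∀ c, ψ c (Walk.nil _) = 0 := fun c => by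
    have := ψ_comp c (Walk.nil _) (Walk.nil _)
    rw [Walk.comp_nil] at this
    exact left_eq_add.1 this
  have ψ_inv : ∀ c u, ψ c (Walk.inv u) = -ψ c u := fun c u => by
    rw [eq_neg_iff_add_eq_zero, ← ψ_comp, ψ_eq _ _ _ (Homotopic.inv_comp I u), ψ_nil]
  refine ⟨Finsupp.linearCombination ℤ θ, fun c u => ?_⟩
  -- A walk telescopes into the loops of its arrows. The chosen walk from a base point to itself
  -- need not be trivial, hence the correction term; it cancels once `u` is closed.
  have key : ∀ {b : V} (u : Walk (base c) b) (hb : comp b = c), ψ c (u.comp (t c b hb).inv) =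
      Finsupp.linearCombination ℤ θ u.chain + ψ c (t c (base c) (hbase c)).inv := by
    intro b u
    induction u using Walk.induction with
    | nil =>
      intro hb
      rw [Walk.chain_nil, map_zero, zero_add, Walk.nil_comp]
    | @arrow b d u α ih =>
      intro hb
      have hb' : comp b = c := (hcomp α).trans hb
      rw [Walk.comp_assoc, ψ_mid c (d := b) u _ (t c b hb'), ih hb', θ_eq, Walk.chain_comp_arrow,
        map_add, Finsupp.linearCombination_single, one_smul]
      abel
    | @invArrow b d u α ih =>
      intro hb
      have hb' : comp b = c := (hcomp α).symm.trans hb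
      have e : (t c b hb').comp ((Walk.invArrow α).comp (t c d hb).inv) =
          ((t c d hb).comp ((Walk.arrow α).comp (t c b hb').inv)).inv := by
        rw [Walk.inv_comp, Walk.inv_comp, Walk.inv_inv, Walk.inv_arrow, Walk.comp_assoc]
      rw [Walk.comp_assoc, ψ_mid c (d := b) u _ (t c b hb'), ih hb', e, ψ_inv c (Walk.comp _ _), θ_eq,
        Walk.chain_comp_invArrow, map_add, Finsupp.linearCombination_single, neg_smul, one_smul]
      abel
  have h := key u (hbase c)
  rw [ψ_comp] at h
  exact add_right_cancel h

/-- The cycles are generated by the chains of closed walks at the base points. -/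
theorem cycles_le_closure {V : Type u} [Quiver.{v} V] {C : Type*} {comp : V → C}
    (hcomp : ∀ {a b : V}, (a ⟶ b) → comp a = comp b) {base : C → V}
    (t : ∀ c b, comp b = c → Walk (base c) b) :
    (cycles V).toAddSubgroup ≤ AddSubgroup.closure
      {z | ∃ (c : C) (u : Walk (base c) (base c)), u.chain = z} := by
  -- Sends a vertex to the chain of the chosen walk reaching it. For an arrow, subtracting `τ` of
  -- its boundary gives the chain of the loop through that arrow; for a cycle it subtracts nothing.
  let τ : (V →₀ ℤ) →ₗ[ℤ] (Total V →₀ ℤ) :=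
    Finsupp.linearCombination ℤ fun b => (t (comp b) b rfl).chain
  have τ_eq : ∀ c b (h : comp b = c), (t c b h).chain = τ (Finsupp.single b 1) := by
    rintro _ b rfl
    simp [τ]
  have key : ∀ z : Total V →₀ ℤ, z - τ (boundary V z) ∈ AddSubgroup.closure
      {z | ∃ (c : C) (u : Walk (base c) (base c)), u.chain = z} := by
    intro z
    induction z using Finsupp.induction_linear with
    | zero => simp
    | add x y hx hy =>
      rw [map_add, map_add, add_sub_add_comm]
      exact add_mem hx hy
    | single α n =>
      have e : Finsupp.single α n = n • Finsupp.single α (1 : ℤ) := by simp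
      rw [e, map_smul, map_smul, ← smul_sub]
      refine zsmul_mem (AddSubgroup.subset_closure ?_) n
      refine ⟨comp α.left, ((t _ α.left rfl).comp (Walk.arrow α.hom)).comp
        (t _ α.right (hcomp α.hom).symm).inv, ?_⟩
      rw [Walk.chain_comp, Walk.chain_comp, Walk.chain_inv, τ_eq, τ_eq, boundary_single, map_sub,
        Walk.chain_arrow]
      abel
  intro z hz
  have h := key z
  rwa [mem_cycles.1 hz, map_zero, sub_zero] at h

/-- The chain of an element of the abelianized fundamental group. -/
def abChain (hI : IsMonomialIdeal I) (x : V) :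
    Abelianization (Pi1 I x) →* Multiplicative (Total V →₀ ℤ) :=
  Abelianization.lift (Pi1.chainHom hI x)

theorem abChain_of (hI : IsMonomialIdeal I) {x : V} (u : Walk x x) :
    abChain hI x (Abelianization.of (Pi1.mk I u)) = Multiplicative.ofAdd u.chain := rfl

/-- `exists_factor_chain` is applied to the abelianization map itself, with `Unit` indexing a single
base point: the class of a loop is a function of its chain, so chain zero forces the trivial class.
-/
theorem abChain_injective (hI : IsMonomialIdeal I) (x : V) (hx : ∀ y : V, Nonempty (Walk x y)) :
    Function.Injective (abChain hI x) := by
  obtain ⟨Θ, hΘ⟩ := exists_factor_chain (I := I) (C := Unit) (comp := fun _ => ()) (fun _ => rfl)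
    (base := fun _ => x) (fun _ => rfl) (fun _ y _ => (hx y).some)
    (M := Additive (Abelianization (Pi1 I x))) (fun _ => Abelianization.of)
  rw [injective_iff_map_eq_one]
  intro g hg
  obtain ⟨g, rfl⟩ := exists_abelianization_of g
  obtain ⟨u, rfl⟩ := g.exists_mk
  rw [abChain_of] at hg
  have h := hΘ () u
  rw [ofAdd_eq_one.1 hg, map_zero] at h
  exact h

theorem mem_range_abChain (hI : IsMonomialIdeal I) (x : V) (hx : ∀ y : V, Nonempty (Walk x y))
    (z : Total V →₀ ℤ) :
    Multiplicative.ofAdd z ∈ (abChain hI x).range ↔ z ∈ cycles V := by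
  constructor
  · rintro ⟨g, hg⟩
    obtain ⟨g, rfl⟩ := exists_abelianization_of g
    obtain ⟨u, rfl⟩ := g.exists_mk
    rw [abChain_of] at hg
    rw [← Multiplicative.ofAdd.injective hg]
    exact u.chain_mem_cycles
  · intro hz
    have h := cycles_le_closure (V := V) (C := Unit) (comp := fun _ => ()) (fun _ => rfl)
      (base := fun _ => x) (fun _ y _ => (hx y).some) hz
    refine (AddSubgroup.closure_le (K := Subgroup.toAddSubgroup' (abChain hI x).range)).2 ?_ h
    rintro _ ⟨_, u, rfl⟩
    exact ⟨_, abChain_of hI u⟩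

/-- The total chain of a family of closed walks, one for each connected component. -/
def prodChainHom (hI : IsMonomialIdeal I) : Pi1Prod I →* Multiplicative (Total V →₀ ℤ) :=
  letI := Fintype.ofFinite (WeaklyConnectedComponent V)
  ∏ c : WeaklyConnectedComponent V, (Pi1.chainHom hI (componentBase c)).comp
    (Pi.evalMonoidHom (fun c => Pi1 I (componentBase c)) c)

open Classical in
theorem prodChainHom_mulSingle (hI : IsMonomialIdeal I) (c : WeaklyConnectedComponent V)
    (x : Pi1 I (componentBase c)) :
    prodChainHom hI (Pi.mulSingle c x) = Pi1.chainHom hI (componentBase c) x := by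
  let _ := Fintype.ofFinite (WeaklyConnectedComponent V)
  rw [prodChainHom, MonoidHom.finsetProd_apply, Finset.prod_eq_single c]
  · rw [MonoidHom.comp_apply, Pi.evalMonoidHom_apply, Pi.mulSingle_eq_same]
  · intro d _ hd
    rw [MonoidHom.comp_apply, Pi.evalMonoidHom_apply, Pi.mulSingle_eq_of_ne hd, map_one]
  · exact fun h => absurd (Finset.mem_univ c) h

/-- The chain of an element of the abelianization of the fundamental group of a bound quiver that
need not be connected. -/
def prodChain (hI : IsMonomialIdeal I) :
    Abelianization (Pi1Prod I) →* Multiplicative (Total V →₀ ℤ) :=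
  Abelianization.lift (prodChainHom hI)

/-- As in the connected case, the abelianization map factors through chains. The factorization holds
on each factor, and a homomorphism from a finite product is determined by its restrictions to the
factors. -/
theorem prodChain_injective (hI : IsMonomialIdeal I) : Function.Injective (prodChain hI) := by
  classical
  obtain ⟨Θ, hΘ⟩ := exists_factor_chain (I := I) (fun α => component_eq_of_arrow α)
    component_componentBase walkFromBase (M := Additive (Abelianization (Pi1Prod I)))
    (fun c => Abelianization.of.comp
      (MonoidHom.mulSingle (fun c => Pi1 I (componentBase c)) c))
  have h : (Abelianization.of : Pi1Prod I →* Abelianization (Pi1Prod I)) =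
      (AddMonoidHom.toMultiplicativeLeft Θ.toAddMonoidHom).comp (prodChainHom hI) := by
    refine MonoidHom.pi_ext fun c x => ?_
    obtain ⟨u, rfl⟩ := x.exists_mk
    rw [MonoidHom.comp_apply, prodChainHom_mulSingle]
    exact hΘ c u
  rw [injective_iff_map_eq_one]
  intro g hg
  obtain ⟨g, rfl⟩ := exists_abelianization_of g
  rw [h, MonoidHom.comp_apply]
  exact (congrArg _ hg).trans (map_one _)

theorem mem_range_prodChain (hI : IsMonomialIdeal I) (z : Total V →₀ ℤ) :
    Multiplicative.ofAdd z ∈ (prodChain hI).range ↔ z ∈ cycles V := by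
  classical
  constructor
  · rintro ⟨g, hg⟩
    obtain ⟨g, rfl⟩ := exists_abelianization_of g
    let K : Subgroup (Multiplicative (Total V →₀ ℤ)) := AddSubgroup.toSubgroup
      (cycles V).toAddSubgroup
    change Multiplicative.ofAdd z ∈ K
    rw [← hg]
    change prodChainHom hI g ∈ K
    rw [prodChainHom, MonoidHom.finsetProd_apply]
    refine prod_mem fun c _ => ?_
    obtain ⟨u, hu⟩ := (g c).exists_mk
    rw [MonoidHom.comp_apply, Pi.evalMonoidHom_apply, hu]
    exact u.chain_mem_cycles
  · intro hz
    have h := cycles_le_closure (fun α => component_eq_of_arrow α) walkFromBase hz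
    refine (AddSubgroup.closure_le (K := Subgroup.toAddSubgroup' (prodChain hI).range)).2 ?_ h
    rintro _ ⟨c, u, rfl⟩
    exact ⟨Abelianization.of (Pi.mulSingle c (Pi1.mk I u)), prodChainHom_mulSingle hI c _⟩

end AbelianizedPi1

/-! ### The induced map on abelianized fundamental groups -/

section AbMap

variable {k : Type w} {V : Type u} [Field k] [Quiver.{v} V] [Fintype V]
  {Q : Subquiver V} {I' : TwoSidedIdeal (PathAlgebra k Q.Vert)}
  {I : TwoSidedIdeal (PathAlgebra k V)}

theorem Subquiver.pi1Map_mk (hc : Q.Compatible I' I) {x₀ : V} {y : Q.Vert} (γ : Walk x₀ y.1)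
    (u : Walk y y) : Subquiver.pi1Map hc γ (Pi1.mk I' u) =
      Pi1.mk I ((γ.comp (Q.mapWalk u)).comp γ.inv) := rfl

theorem Subquiver.chain_mapWalk {V : Type u} [Quiver.{v} V] {Q : Subquiver V} {a b : Q.Vert} (u : Walk a b) :
    (Q.mapWalk u).chain = u.chain.mapDomain (mapTotal Q.incl) := Walk.chain_map Q.incl u

/-- The contributions of `γ` and `γ.inv` cancel, so the connecting walks leave no trace on chains.
-/
theorem Subquiver.chainHom_pi1Map (hI' : IsMonomialIdeal I') (hI : IsMonomialIdeal I)
    (hc : Q.Compatible I' I) {x₀ : V} {y : Q.Vert} (γ : Walk x₀ y.1) (g : Pi1 I' y) :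
    (Pi1.chainHom hI x₀ (Subquiver.pi1Map hc γ g)).toAdd =
      (Pi1.chainHom hI' y g).toAdd.mapDomain (mapTotal Q.incl) := by
  obtain ⟨u, rfl⟩ := g.exists_mk
  rw [Subquiver.pi1Map_mk, Pi1.chainHom_mk, Pi1.chainHom_mk, toAdd_ofAdd, toAdd_ofAdd,
    Walk.chain_comp, Walk.chain_comp, Walk.chain_inv, Subquiver.chain_mapWalk]
  abel

open Classical in
theorem Subquiver.abMap_of (hc : Q.Compatible I' I) {x₀ : V}
    (γ : ∀ c : WeaklyConnectedComponent Q.Vert, Walk x₀ (componentBase c).1) (g : Pi1Prod I') :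
    letI := Fintype.ofFinite (WeaklyConnectedComponent Q.Vert)
    Subquiver.abMap hc γ (Abelianization.of g) =
      ∏ c, Abelianization.of (Subquiver.pi1Map hc (γ c) (g c)) := by
  rw [Subquiver.abMap, Abelianization.lift_apply_of, MonoidHom.finsetProd_apply]
  rfl

theorem Subquiver.abChain_abMap (hI' : IsMonomialIdeal I') (hI : IsMonomialIdeal I)
    (hc : Q.Compatible I' I) {x₀ : V}
    (γ : ∀ c : WeaklyConnectedComponent Q.Vert, Walk x₀ (componentBase c).1)
    (g : Abelianization (Pi1Prod I')) :
    (abChain hI x₀ (Subquiver.abMap hc γ g)).toAdd =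
      (prodChain hI' g).toAdd.mapDomain (mapTotal Q.incl) := by
  let _ := Fintype.ofFinite (WeaklyConnectedComponent Q.Vert)
  obtain ⟨g, rfl⟩ := exists_abelianization_of g
  rw [Subquiver.abMap_of, map_prod, toAdd_prod, prodChain, Abelianization.lift_apply_of,
    prodChainHom, MonoidHom.finsetProd_apply, toAdd_prod, Finsupp.mapDomain_finsetSum]
  exact Finset.sum_congr rfl fun c _ => Subquiver.chainHom_pi1Map hI' hI hc (γ c) (g c)

/-- On chains the map is extension by zero from the arrows of the subquiver, which is injective. -/
theorem Subquiver.abMap_injective (hI' : IsMonomialIdeal I') (hI : IsMonomialIdeal I)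
    (hc : Q.Compatible I' I) {x₀ : V}
    (γ : ∀ c : WeaklyConnectedComponent Q.Vert, Walk x₀ (componentBase c).1) :
    Function.Injective (Subquiver.abMap hc γ) := by
  intro g h e
  apply prodChain_injective hI'
  apply Multiplicative.toAdd.injective
  apply Finsupp.mapDomain_injective Q.mapTotal_incl_injective
  rw [← Subquiver.abChain_abMap hI' hI hc γ, ← Subquiver.abChain_abMap hI' hI hc γ, e]

/-- The image of the induced map consists of the classes whose cycles lie in the subquiver. -/
theorem Subquiver.mem_range_abMap (hI' : IsMonomialIdeal I') (hI : IsMonomialIdeal I)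
    (hc : Q.Compatible I' I) {x₀ : V} (hx : ∀ y : V, Nonempty (Walk x₀ y))
    (γ : ∀ c : WeaklyConnectedComponent Q.Vert, Walk x₀ (componentBase c).1)
    (y : Abelianization (Pi1 I x₀)) :
    y ∈ (Subquiver.abMap hc γ).range ↔
      ∃ z ∈ cycles Q.Vert, z.mapDomain (mapTotal Q.incl) = (abChain hI x₀ y).toAdd := by
  constructor
  · rintro ⟨g, rfl⟩
    exact ⟨_, (mem_range_prodChain hI' _).1 ⟨g, rfl⟩,
      (Subquiver.abChain_abMap hI' hI hc γ g).symm⟩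
  · rintro ⟨z, hz, e⟩
    obtain ⟨g, hg⟩ := (mem_range_prodChain hI' z).2 hz
    refine ⟨g, abChain_injective hI x₀ hx (Multiplicative.toAdd.injective ?_)⟩
    rw [Subquiver.abChain_abMap hI' hI hc γ, hg, ← e, toAdd_ofAdd]

/-- The chain of a contraction generator is that of the closed walk through `u` and back along `u'`,
which lies in the subquiver. Conversely, a loop at the base point of a component of the subquiver
gives a generator with `u'` trivial. -/
theorem Subquiver.map_contractionSubgroup (hI' : IsMonomialIdeal I') (hI : IsMonomialIdeal I)
    (hc : Q.Compatible I' I) {x₀ : V} (hx : ∀ y : V, Nonempty (Walk x₀ y))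
    (γ : ∀ c : WeaklyConnectedComponent Q.Vert, Walk x₀ (componentBase c).1) :
    (Q.contractionSubgroup I x₀).map Abelianization.of = (Subquiver.abMap hc γ).range := by
  apply le_antisymm
  · rw [Subquiver.contractionSubgroup, Subgroup.map_le_iff_le_comap, Subgroup.closure_le]
    rintro _ ⟨a, b, u, u', z, rfl⟩
    refine (Subquiver.mem_range_abMap hI' hI hc hx γ _).2
      ⟨(u.comp u'.inv).chain, (u.comp u'.inv).chain_mem_cycles, ?_⟩
    rw [abChain_of, toAdd_ofAdd]
    simp only [Walk.chain_comp, Walk.chain_inv, Subquiver.chain_mapWalk, Finsupp.mapDomain_add]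
    have : (-u'.chain).mapDomain (mapTotal Q.incl) = -(u'.chain.mapDomain (mapTotal Q.incl)) :=
      map_neg (Finsupp.mapDomain.addMonoidHom (mapTotal Q.incl)) u'.chain
    rw [this]
    abel
  · rintro _ ⟨g, rfl⟩
    obtain ⟨g, rfl⟩ := exists_abelianization_of g
    rw [Subquiver.abMap_of]
    refine prod_mem fun c _ => Subgroup.mem_map_of_mem _ (Subgroup.subset_closure ?_)
    obtain ⟨u, hu⟩ := (g c).exists_mk
    rw [hu]
    exact ⟨_, _, u, Walk.nil _, γ c, rfl⟩

end AbMap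

/-- The abelianization of a quotient is a quotient of the abelianization. -/
theorem exists_abelianization_quotient_equiv {G : Type*} [Group G] (N : Subgroup G) [N.Normal]
    (S : Subgroup (Abelianization G)) (h : N.map Abelianization.of = S) :
    ∃ e : Abelianization (G ⧸ N) ≃* Abelianization G ⧸ S, ∀ g : G,
      e (Abelianization.of (QuotientGroup.mk g)) = QuotientGroup.mk (Abelianization.of g) := by
  subst h
  let f : Abelianization (G ⧸ N) →* Abelianization G ⧸ N.map Abelianization.of :=
    Abelianization.lift (QuotientGroup.lift N ((QuotientGroup.mk' _).comp Abelianization.of)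
      fun g hg => (QuotientGroup.eq_one_iff _).2 (Subgroup.mem_map_of_mem _ hg))
  let f' : Abelianization G ⧸ N.map Abelianization.of →* Abelianization (G ⧸ N) :=
    QuotientGroup.lift _ (Abelianization.map (QuotientGroup.mk' N)) (by
      rintro _ ⟨g, hg, rfl⟩
      rw [MonoidHom.mem_ker, Abelianization.map_of, QuotientGroup.mk'_apply, (QuotientGroup.eq_one_iff g).2 hg,
        map_one])
  refine ⟨MonoidHom.toMulEquiv f f' ?_ ?_, fun g => rfl⟩
  · ext g
    rfl
  · ext g
    rfl

/-! ### Cycles of the relative quiver -/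

section Rel

variable {V : Type u} [Quiver.{v} V]

theorem Joined.mono {W W' : WideSubquiver V} (h : ∀ a b, W a b ⊆ W' a b) {a b : V}
    (hj : Joined W a b) : Joined W' a b := by
  obtain ⟨p⟩ := hj
  let F : W ⥤q W' := { obj := fun a => a, map := fun α => ⟨α.1, h _ _ α.2⟩ }
  exact ⟨p.map F⟩

theorem Joined.nonempty_walk {W : WideSubquiver V} {a b : V} (hj : Joined W a b) :
    Nonempty (Walk a b) := by
  obtain ⟨p⟩ := hj
  exact ⟨p.map (wideIncl W)⟩

variable {Q : Subquiver V} {T : WideSubquiver V}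

/-- Provides a substitute for `β` inside the forest: the maximal forest joins any two vertices that
the subquiver joins. -/
theorem Subquiver.exists_tree_chain (hT : Q.IsExtendedMaximalTree T) (β : Total V)
    (hβ : β.hom ∈ Q.arrows β.left β.right) :
    ∃ z : Total V →₀ ℤ, boundary V z = Finsupp.single β.right 1 - Finsupp.single β.left 1 ∧
      z ∈ Finsupp.supported ℤ ℤ {α : Total V | α.hom ∈ Q.treePart T α.left α.right} := by
  let e : toWide Q.arrows β.left ⟶ toWide Q.arrows β.right := ⟨β.hom, hβ⟩
  obtain ⟨p⟩ := hT.2.2.2.2 β.left β.right ⟨Walk.arrow e⟩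
  exact ⟨(p.map (wideIncl _)).chain, boundary_chain _, fun α hα => chain_wide_support p α hα⟩

/-- Every cycle is the sum of a cycle of the relative quiver and one of the subquiver. -/
theorem Subquiver.exists_cycle_decomposition (hT : Q.IsExtendedMaximalTree T)
    {z : Total V →₀ ℤ} (hz : z ∈ cycles V) :
    ∃ x ∈ cycles (Q.relQuiver T), ∃ y ∈ cycles Q.Vert,
      x.mapDomain (mapTotal (wideIncl (Q.relQuiver T))) + y.mapDomain (mapTotal Q.incl) = z := by
  classical
  choose! c hc using Subquiver.exists_tree_chain hT
  -- An arrow of the subquiver goes to the cycle it closes with its forest substitute, any other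
  -- arrow to zero. Thus `κ z` is always a cycle in the subquiver, and `z - κ z` is `z` with the
  -- arrows of the subquiver replaced by forest chains.
  let κ : (Total V →₀ ℤ) →ₗ[ℤ] (Total V →₀ ℤ) := Finsupp.linearCombination ℤ fun β =>
    if β.hom ∈ Q.arrows β.left β.right then Finsupp.single β 1 - c β else 0
  have hκ : ∀ β, κ (Finsupp.single β 1) =
      if β.hom ∈ Q.arrows β.left β.right then Finsupp.single β 1 - c β else 0 := fun β => by
    simp only [κ, Finsupp.linearCombination_single, one_smul]
  have single_eq : ∀ (β : Total V) (n : ℤ), Finsupp.single β n = n • Finsupp.single β (1 : ℤ) :=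
    fun β n => by simp
  have h1 : ∀ z, boundary V (κ z) = 0 := by
    intro z
    induction z using Finsupp.induction_linear with
    | zero => simp
    | add x y hx hy => rw [map_add, map_add, hx, hy, add_zero]
    | single β n =>
      rw [single_eq, map_smul, map_smul, hκ]
      split_ifs with h
      · rw [map_sub, boundary_single, (hc β h).1, sub_self, smul_zero]
      · rw [map_zero, smul_zero]
  have h2 : ∀ z, κ z ∈ Finsupp.supported ℤ ℤ {α : Total V | α.hom ∈ Q.arrows α.left α.right} := by
    intro z
    induction z using Finsupp.induction_linear with
    | zero => rw [map_zero]; exact zero_mem _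
    | add x y hx hy => rw [map_add]; exact add_mem hx hy
    | single β n =>
      rw [single_eq, map_smul, hκ]
      refine Submodule.smul_mem _ _ ?_
      split_ifs with h
      · exact sub_mem (Finsupp.single_mem_supported _ _ h)
          (Finsupp.supported_mono (fun α hα => hα.2) (hc β h).2)
      · exact zero_mem _
  have h3 : ∀ z, z - κ z ∈
      Finsupp.supported ℤ ℤ {α : Total V | α.hom ∈ Q.relQuiver T α.left α.right} := by
    intro z
    induction z using Finsupp.induction_linear with
    | zero => rw [map_zero, sub_zero]; exact zero_mem _
    | add x y hx hy => rw [map_add, add_sub_add_comm]; exact add_mem hx hy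
    | single β n =>
      rw [single_eq, map_smul, hκ, ← smul_sub]
      refine Submodule.smul_mem _ _ ?_
      split_ifs with h
      · rw [sub_sub_cancel]
        exact Finsupp.supported_mono (fun α hα => Or.inr hα.1) (hc β h).2
      · rw [sub_zero]
        exact Finsupp.single_mem_supported _ _ (Or.inl h)
  obtain ⟨x, hx⟩ := exists_mapDomain_eq (f := mapTotal (wideIncl (Q.relQuiver T))) (z - κ z)
    fun α hα => by rw [range_mapTotal_wideIncl]; exact h3 z hα
  obtain ⟨y, hy⟩ := exists_mapDomain_eq (f := mapTotal Q.incl) (κ z)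
    fun α hα => by rw [Subquiver.range_mapTotal_incl]; exact h2 z hα
  refine ⟨x, mem_cycles_of_mapDomain (wideIncl _) (fun _ _ h => h) ?_, y,
    mem_cycles_of_mapDomain Q.incl Subtype.val_injective ?_, ?_⟩
  · rw [hx]
    exact sub_mem hz (h1 z)
  · rw [hy]
    exact h1 z
  · rw [hx, hy, sub_add_cancel]

/-- The cycles of the relative quiver and those of the subquiver are independent. -/
theorem Subquiver.eq_zero_of_cycle_decomposition (hT : Q.IsExtendedMaximalTree T)
    {x : Total (Q.relQuiver T) →₀ ℤ} (hx : x ∈ cycles (Q.relQuiver T)) {y : Total Q.Vert →₀ ℤ}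
    (h : x.mapDomain (mapTotal (wideIncl (Q.relQuiver T))) =
      y.mapDomain (mapTotal Q.incl)) : x = 0 ∧ y = 0 := by
  classical
  -- The common chain uses only arrows that lie in the subquiver and also in the relative quiver.
  -- Such arrows belong to `T`, and a forest carries no non-zero cycle.
  have h0 : x.mapDomain (mapTotal (wideIncl (Q.relQuiver T))) = 0 := by
    refine hT.1.eq_zero (mapDomain_mem_cycles _ hx) fun α hα => ?_
    have h1 : α ∈ Set.range (mapTotal (wideIncl (Q.relQuiver T))) := by
      obtain ⟨β, -, rfl⟩ := Finset.mem_image.1 (Finsupp.mapDomain_support hα)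
      exact ⟨β, rfl⟩
    have h2 : α ∈ Set.range (mapTotal Q.incl) := by
      rw [h] at hα
      obtain ⟨β, -, rfl⟩ := Finset.mem_image.1 (Finsupp.mapDomain_support hα)
      exact ⟨β, rfl⟩
    rw [range_mapTotal_wideIncl] at h1
    rw [Subquiver.range_mapTotal_incl] at h2
    exact h1.resolve_left fun h => h h2
  refine ⟨Finsupp.mapDomain_injective (mapTotal_wideIncl_injective _)
    (h0.trans Finsupp.mapDomain_zero.symm), Finsupp.mapDomain_injective Q.mapTotal_incl_injective
    ((h.symm.trans h0).trans Finsupp.mapDomain_zero.symm)⟩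

instance (W : WideSubquiver V) [∀ a b : V, Finite (a ⟶ b)] (a b : W) : Finite (a ⟶ b) :=
  inferInstanceAs (Finite {f : (show V from a) ⟶ (show V from b) // f ∈ W a b})

instance (Q : Subquiver V) [∀ a b : V, Finite (a ⟶ b)] (a b : Q.Vert) : Finite (a ⟶ b) :=
  inferInstanceAs (Finite {f : a.1 ⟶ b.1 // f ∈ Q.arrows a.1 b.1})

/-- The sum of the cycles of the relative quiver and of those of the subquiver. -/
def Subquiver.cycleSum (Q : Subquiver V) (T : WideSubquiver V) :
    cycles (Q.relQuiver T) × cycles Q.Vert →ₗ[ℤ] cycles V :=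
  LinearMap.codRestrict (cycles V)
    (((Finsupp.lmapDomain ℤ ℤ (mapTotal (wideIncl (Q.relQuiver T)))).comp
      (cycles (Q.relQuiver T)).subtype).coprod
        ((Finsupp.lmapDomain ℤ ℤ (mapTotal Q.incl)).comp (cycles Q.Vert).subtype))
    fun x => add_mem (mapDomain_mem_cycles _ x.1.2) (mapDomain_mem_cycles _ x.2.2)

theorem Subquiver.cycleSum_bijective (hT : Q.IsExtendedMaximalTree T) :
    Function.Bijective (Q.cycleSum T) := by
  constructor
  · rw [injective_iff_map_eq_zero]
    rintro ⟨⟨x, hx⟩, ⟨y, hy⟩⟩ h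
    have h1 : x.mapDomain (mapTotal (wideIncl (Q.relQuiver T))) +
        y.mapDomain (mapTotal Q.incl) = 0 := congrArg Subtype.val h
    have h2 : (-y).mapDomain (mapTotal Q.incl) = -(y.mapDomain (mapTotal Q.incl)) :=
      map_neg (Finsupp.mapDomain.addMonoidHom (mapTotal Q.incl)) y
    obtain ⟨hx0, hy0⟩ := Subquiver.eq_zero_of_cycle_decomposition hT hx
      ((eq_neg_of_add_eq_zero_left h1).trans h2.symm)
    exact Prod.ext (Subtype.ext hx0) (Subtype.ext (neg_eq_zero.1 hy0))
  · rintro ⟨z, hz⟩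
    obtain ⟨x, hx, y, hy, h⟩ := Subquiver.exists_cycle_decomposition hT hz
    exact ⟨⟨⟨x, hx⟩, ⟨y, hy⟩⟩, Subtype.ext h⟩

/-- Betti numbers are ranks of cycle groups, and ranks add along the decomposition `cycleSum`. -/
theorem Subquiver.betti_relQuiver [Fintype V] [∀ a b : V, Finite (a ⟶ b)]
    (hT : Q.IsExtendedMaximalTree T) :
    betti (Q.relQuiver T) = betti V - betti Q.Vert := by
  rw [← finrank_cycles, ← finrank_cycles, ← finrank_cycles,
    ← (LinearEquiv.ofBijective _ (Subquiver.cycleSum_bijective hT)).finrank_eq,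
    Module.finrank_prod]
  push_cast
  ring

end Rel

/-- A complement, in the image of an injective homomorphism, of the image of a subgroup is
isomorphic to the quotient by that subgroup. -/
theorem nonempty_mulEquiv_quotient {R X D : Type*} [CommGroup R] [CommGroup X] [CommGroup D]
    {f : X →* D} (hf : Function.Injective f) {g : R →* D} (S : Subgroup X)
    (hg : g.range ≤ f.range) (hinf : ∀ r, ∀ s ∈ S, g r = f s → r = 1)
    (hsup : ∀ x, ∃ r, ∃ s ∈ S, f x = g r * f s) : Nonempty (R ≃* X ⧸ S) := by
  let h : R →* X := (MonoidHom.ofInjective hf).symm.toMonoidHom.comp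
    (g.codRestrict f.range fun r => hg ⟨r, rfl⟩)
  have hh : ∀ r, f (h r) = g r := fun r => by
    have := congrArg Subtype.val ((MonoidHom.ofInjective hf).apply_symm_apply
      (g.codRestrict f.range (fun r => hg ⟨r, rfl⟩) r))
    exact this
  refine ⟨MulEquiv.ofBijective ((QuotientGroup.mk' S).comp h) ⟨?_, ?_⟩⟩
  · rw [injective_iff_map_eq_one]
    intro r hr
    exact hinf r (h r) ((QuotientGroup.eq_one_iff _).1 hr) (hh r).symm
  · intro x
    obtain ⟨x, rfl⟩ := QuotientGroup.mk_surjective x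
    obtain ⟨r, s, hs, e⟩ := hsup x
    refine ⟨r, ?_⟩
    rw [MonoidHom.comp_apply, QuotientGroup.mk'_apply, QuotientGroup.eq]
    have : x = h r * s := hf (by rw [e, map_mul, hh])
    rwa [this, inv_mul_cancel_left]

/-- Read on chains: the cycles of the relative quiver form a complement, among all cycles, of those
of the subquiver, and the latter are the range of `abMap`. -/
theorem Subquiver.nonempty_relPi1_equiv {k : Type w} {V : Type u} [Field k] [Quiver.{v} V]
    [Fintype V] {Q : Subquiver V} {I' : TwoSidedIdeal (PathAlgebra k Q.Vert)}
    {I : TwoSidedIdeal (PathAlgebra k V)} (hI' : IsMonomialIdeal I') (hI : IsMonomialIdeal I)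
    (hc : Q.Compatible I' I) {x₀ : V} {T : WideSubquiver V} (hT : Q.IsExtendedMaximalTree T)
    (hx : ∀ y : V, Nonempty (Walk x₀ y))
    (hx' : ∀ y : Q.relQuiver T, Nonempty (Walk (toWide (Q.relQuiver T) x₀) y))
    (γ : ∀ c : WeaklyConnectedComponent Q.Vert, Walk x₀ (componentBase c).1) :
    Nonempty (Abelianization (Q.RelPi1 k T x₀) ≃*
      Abelianization (Pi1 I x₀) ⧸ (Subquiver.abMap hc γ).range) := by
  let m : Multiplicative (Total (Q.relQuiver T) →₀ ℤ) →* Multiplicative (Total V →₀ ℤ) :=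
    AddMonoidHom.toMultiplicative
      (Finsupp.mapDomain.addMonoidHom (mapTotal (wideIncl (Q.relQuiver T))))
  let a := abChain (I := (⊥ : TwoSidedIdeal (PathAlgebra k (Q.relQuiver T))))
    isMonomialIdeal_bot (toWide (Q.relQuiver T) x₀)
  have ha := mem_range_abChain (I := (⊥ : TwoSidedIdeal (PathAlgebra k (Q.relQuiver T))))
    isMonomialIdeal_bot (toWide (Q.relQuiver T) x₀) hx'
  refine nonempty_mulEquiv_quotient (abChain_injective hI x₀ hx) (g := m.comp a) _ ?_ ?_ ?_
  · rintro _ ⟨r, rfl⟩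
    exact (mem_range_abChain hI x₀ hx _).2 (mapDomain_mem_cycles _ ((ha _).1 ⟨r, rfl⟩))
  · intro r s hs e
    obtain ⟨y, -, hy⟩ := (Subquiver.mem_range_abMap hI' hI hc hx γ s).1 hs
    have h0 := (Subquiver.eq_zero_of_cycle_decomposition hT ((ha _).1 ⟨r, rfl⟩)
      ((congrArg Multiplicative.toAdd e).trans hy.symm)).1
    exact abChain_injective _ _ hx' ((Multiplicative.toAdd.injective h0).trans (map_one _).symm)
  · intro g
    obtain ⟨x, hxc, y, hy, h⟩ := Subquiver.exists_cycle_decomposition hT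
      ((mem_range_abChain hI x₀ hx _).1 ⟨g, rfl⟩)
    obtain ⟨r, hr⟩ := (ha x).2 hxc
    obtain ⟨s, hs⟩ := (mem_range_abChain hI x₀ hx _).2 (mapDomain_mem_cycles Q.incl hy)
    refine ⟨r, s, (Subquiver.mem_range_abMap hI' hI hc hx γ s).2 ⟨y, hy, ?_⟩, ?_⟩
    · rw [hs, toAdd_ofAdd]
    · rw [hs, MonoidHom.comp_apply, hr]
      exact congrArg Multiplicative.ofAdd h.symm

/-! ### Homomorphisms to the additive group of the field -/

section Dual

variable {k : Type w} [Field k]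

/-- Homomorphisms to `k⁺` from a group `G` induced by those from a group `Z` that is identified
with the abelianization of `G`. -/
def dualGroupMap {G Z : Type*} [Group G] [AddCommGroup Z]
    (e : Abelianization G ≃* Multiplicative Z) : (Z →ₗ[ℤ] k) →ₗ[k] DualGroup k G where
  toFun ψ := AddMonoidHom.toMultiplicativeRight.symm
    ((AddMonoidHom.toMultiplicative ψ.toAddMonoidHom).comp (e.toMonoidHom.comp Abelianization.of))
  map_add' _ _ := rfl
  map_smul' _ _ := rfl

theorem dualGroupMap_bijective {G Z : Type*} [Group G] [AddCommGroup Z]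
    (e : Abelianization G ≃* Multiplicative Z) :
    Function.Bijective (dualGroupMap (k := k) e) := by
  constructor
  · intro ψ ψ' h
    ext z
    obtain ⟨g, hg⟩ := exists_abelianization_of (e.symm (Multiplicative.ofAdd z))
    have h1 : ψ (e (Abelianization.of g)).toAdd = ψ' (e (Abelianization.of g)).toAdd :=
      DFunLike.congr_fun h (Additive.ofMul g)
    rwa [hg, e.apply_symm_apply, toAdd_ofAdd] at h1
  · intro φ
    let f : Abelianization G →* Multiplicative k :=
      Abelianization.lift (AddMonoidHom.toMultiplicativeRight φ)
    refine ⟨(AddMonoidHom.toMultiplicative.symm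
      (f.comp e.symm.toMonoidHom)).toIntLinearMap, DFunLike.ext _ _ fun g => ?_⟩
    change (f (e.symm (e (Abelianization.of g.toMul)))).toAdd = φ g
    rw [e.symm_apply_apply]
    rfl

/-- Since `k⁺` is abelian, homomorphisms factor through the abelianization, here the free group `Z`;
their values on a basis are arbitrary. -/
theorem nonempty_dualGroup_equiv {G E : Type*} [Group G] [AddCommGroup E] (Z : Submodule ℤ E)
    [Module.Free ℤ Z] [Module.Finite ℤ Z] (f : Abelianization G →* Multiplicative E)
    (hf : Function.Injective f) (hr : ∀ z, Multiplicative.ofAdd z ∈ f.range ↔ z ∈ Z) :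
    Nonempty (DualGroup k G ≃ₗ[k] (Fin (Module.finrank ℤ Z) → k)) := by
  let F : Abelianization G →* Multiplicative Z :=
    { toFun := fun g => Multiplicative.ofAdd ⟨(f g).toAdd, (hr _).1 ⟨g, rfl⟩⟩
      map_one' := congrArg Multiplicative.ofAdd (Subtype.ext (congrArg Multiplicative.toAdd
        (map_one f)))
      map_mul' := fun g h => congrArg Multiplicative.ofAdd (Subtype.ext
        (congrArg Multiplicative.toAdd (map_mul f g h))) }
  have hF : Function.Bijective F := by
    constructor
    · intro g h e
      exact hf (Multiplicative.toAdd.injective (congrArg (fun z => (Multiplicative.toAdd z).1) e))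
    · intro z
      obtain ⟨g, hg⟩ := (hr z.toAdd.1).2 z.toAdd.2
      exact ⟨g, congrArg Multiplicative.ofAdd (Subtype.ext (congrArg Multiplicative.toAdd hg))⟩
  exact ⟨(LinearEquiv.ofBijective _ (dualGroupMap_bijective (MulEquiv.ofBijective F hF))).symm.trans
    ((Module.finBasis ℤ Z).constr k).symm⟩

variable {V : Type u} [Quiver.{v} V] [Fintype V] {I : TwoSidedIdeal (PathAlgebra k V)}

theorem Homotopic.of_bot {a b : V} {u w : Walk a b}
    (h : Homotopic (⊥ : TwoSidedIdeal (PathAlgebra k V)) u w) : Homotopic I u w := by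
  induction h with
  | refl u => exact Homotopic.refl _
  | symm _ ih => exact ih.symm
  | trans _ _ ih ih' => exact ih.trans ih'
  | comp _ _ ih ih' => exact ih.comp ih'
  | inv_arrow α => exact Homotopic.inv_arrow α
  | arrow_inv α => exact Homotopic.arrow_inv α
  | rel p q r hr hp hq => exact absurd ((TwoSidedIdeal.mem_bot _).1 hr.1) hr.2.1

/-- The projection from the fundamental group of a quiver to that of a bound quiver. -/
def Pi1.ofBot (I : TwoSidedIdeal (PathAlgebra k V)) (x : V) :
    Pi1 (⊥ : TwoSidedIdeal (PathAlgebra k V)) x →* Pi1 I x where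
  toFun := Quotient.map id fun _ _ h => Homotopic.of_bot h
  map_one' := rfl
  map_mul' := by
    rintro ⟨u⟩ ⟨w⟩
    rfl

theorem Pi1.ofBot_surjective (x : V) : Function.Surjective (Pi1.ofBot I x) := by
  rintro ⟨u⟩
  exact ⟨Pi1.mk _ u, rfl⟩

variable [∀ a b : V, Finite (a ⟶ b)]

theorem rank_dualGroup_pi1Prod (hI : IsMonomialIdeal I) :
    Module.rank k (DualGroup k (Pi1Prod I)) = Module.finrank ℤ (cycles V) := by
  obtain ⟨e⟩ := nonempty_dualGroup_equiv (k := k) (cycles V) (prodChain hI)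
    (prodChain_injective hI) (mem_range_prodChain hI)
  have := e.lift_rank_eq
  rw [rank_fin_fun, Cardinal.lift_natCast, Cardinal.lift_eq_nat_iff] at this
  exact this

/-- For any ideal, `π₁(Q, I)` is a quotient of `π₁(Q)`, and homomorphisms pull back injectively
along a surjection. Without relations the dimension is exactly the rank of the cycles. -/
theorem rank_dualGroup_pi1Prod_le :
    Module.rank k (DualGroup k (Pi1Prod I)) ≤ Module.finrank ℤ (cycles V) := by
  rw [← rank_dualGroup_pi1Prod (k := k) (V := V) isMonomialIdeal_bot]
  let π : Pi1Prod (⊥ : TwoSidedIdeal (PathAlgebra k V)) →* Pi1Prod I :=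
    MonoidHom.pi fun c => (Pi1.ofBot I _).comp (Pi.evalMonoidHom _ c)
  have hπ : Function.Surjective π := fun g => by
    choose h hh using fun c => Pi1.ofBot_surjective (I := I) _ (g c)
    exact ⟨h, funext hh⟩
  let L : DualGroup k (Pi1Prod I) →ₗ[k]
      DualGroup k (Pi1Prod (⊥ : TwoSidedIdeal (PathAlgebra k V))) :=
    { toFun := fun φ => φ.comp (MonoidHom.toAdditive π)
      map_add' := fun _ _ => rfl
      map_smul' := fun _ _ => rfl }
  refine LinearMap.rank_le_of_injective L fun φ ψ h => ?_
  refine DFunLike.ext _ _ fun g => ?_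
  obtain ⟨g', hg'⟩ := hπ g.toMul
  have := DFunLike.congr_fun h (Additive.ofMul g')
  change φ (Additive.ofMul (π g')) = ψ (Additive.ofMul (π g')) at this
  rw [hg'] at this
  exact this

theorem nonempty_dualGroup_pi1_equiv (hI : IsMonomialIdeal I) (x : V)
    (hx : ∀ y : V, Nonempty (Walk x y)) :
    Nonempty (DualGroup k (Pi1 I x) ≃ₗ[k] (Fin (Module.finrank ℤ (cycles V)) → k)) :=
  nonempty_dualGroup_equiv (cycles V) (abChain hI x) (abChain_injective hI x hx)
    (mem_range_abChain hI x hx)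

end Dual

/-! ### The quiver data of an algebra are determined by the algebra -/

section PathLength

variable {k : Type w} {V : Type u} [Field k] [Quiver.{v} V]

theorem PathAlgebra.eq_sum (x : PathAlgebra k V) :
    x = ∑ p ∈ x.toFinsupp.support, x.toFinsupp p • PathAlgebra.path k p := by
  have h := (Finsupp.sum_single x.toFinsupp).symm
  refine h.trans (Finset.sum_congr rfl fun p _ => ?_)
  exact (Finsupp.smul_single_one p _).symm

/-- The span of the paths of length at least `n`. -/
def lengthSpan (k : Type w) (V : Type u) [Field k] [Quiver.{v} V] (n : ℕ) :
    Submodule k (PathAlgebra k V) :=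
  Submodule.span k (PathAlgebra.path k '' {p | n ≤ p.2.2.length})

theorem path_mem_lengthSpan {n : ℕ} {p : AnyPath V} (h : n ≤ p.2.2.length) :
    PathAlgebra.path k p ∈ lengthSpan k V n := Submodule.subset_span ⟨p, h, rfl⟩

theorem mem_lengthSpan {n : ℕ} {x : PathAlgebra k V} :
    x ∈ lengthSpan k V n ↔ ∀ p, x.toFinsupp p ≠ 0 → n ≤ p.2.2.length := by
  classical
  constructor
  · intro hx p hp
    by_contra hn
    apply hp
    induction hx using Submodule.span_induction with
    | mem y hy =>
      obtain ⟨q, hq, rfl⟩ := hy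
      rw [PathAlgebra.toFinsupp_path, Finsupp.single_apply, if_neg]
      rintro rfl
      exact hn hq
    | zero => rfl
    | add y z _ _ hy hz =>
      by_cases h1 : y.toFinsupp p = 0
      · by_cases h2 : z.toFinsupp p = 0
        · change y.toFinsupp p + z.toFinsupp p = 0
          rw [h1, h2, add_zero]
        · exact absurd (hz h2) h2
      · exact absurd (hy h1) h1
    | smul c y _ hy =>
      by_cases h1 : y.toFinsupp p = 0
      · change c * y.toFinsupp p = 0
        rw [h1, mul_zero]
      · exact absurd (hy h1) h1
  · intro h
    rw [x.eq_sum]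
    exact sum_mem fun p hp => Submodule.smul_mem _ _
      (path_mem_lengthSpan (h p (Finsupp.mem_support_iff.1 hp)))

/-- The coefficients of a family of paths. -/
def pathCoeffs {ι : Type*} (j : ι → AnyPath V) : PathAlgebra k V →ₗ[k] (ι → k) where
  toFun x i := x.toFinsupp (j i)
  map_add' _ _ := rfl
  map_smul' _ _ := rfl

theorem pathCoeffs_surjective {ι : Type*} [Finite ι] {j : ι → AnyPath V}
    (hj : Function.Injective j) : Function.Surjective (pathCoeffs (k := k) j) := by
  intro f
  refine ⟨PathAlgebra.ofFinsupp ((Finsupp.equivFunOnFinite.symm f).mapDomain j), funext fun i => ?_⟩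
  exact Finsupp.mapDomain_apply hj _ i

theorem ker_pathCoeffs {ι : Type*} {j : ι → AnyPath V} {n : ℕ}
    (hj : ∀ p : AnyPath V, p ∈ Set.range j ↔ p.2.2.length < n) :
    LinearMap.ker (pathCoeffs (k := k) j) = lengthSpan k V n := by
  ext x
  rw [LinearMap.mem_ker, mem_lengthSpan]
  constructor
  · intro h p hp
    by_contra hn
    obtain ⟨i, rfl⟩ := (hj p).2 (not_le.1 hn)
    exact hp (congrFun h i)
  · intro h
    funext i
    by_contra hi
    exact absurd ((hj (j i)).1 ⟨i, rfl⟩) (not_lt.2 (h _ hi))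

/-- The trivial path at a vertex. -/
def trivialPath (a : V) : AnyPath V := ⟨a, a, Path.nil⟩

/-- An arrow as a path. -/
def arrowPath (α : Total V) : AnyPath V := ⟨α.left, α.right, α.hom.toPath⟩

theorem trivialPath_injective : Function.Injective (trivialPath (V := V)) :=
  fun _ _ h => congrArg Sigma.fst h

theorem arrowPath_injective : Function.Injective (arrowPath (V := V)) := by
  rintro ⟨a, b, α⟩ ⟨a', b', α'⟩ h
  have h1 : a = a' := congrArg Sigma.fst h
  subst h1
  have h2 : b = b' := congrArg (fun z : AnyPath V => z.2.1) h
  subst h2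
  have h3 : α.toPath = α'.toPath := eq_of_heq (Sigma.mk.inj (eq_of_heq (Sigma.mk.inj h).2)).2
  have h4 : α = α' := by
    simpa [Quiver.Hom.toPath] using h3
  rw [h4]

theorem mem_range_trivialPath (p : AnyPath V) :
    p ∈ Set.range (trivialPath (V := V)) ↔ p.2.2.length < 1 := by
  constructor
  · rintro ⟨a, rfl⟩
    exact Nat.zero_lt_one
  · obtain ⟨a, b, p⟩ := p
    intro h
    cases p with
    | nil => exact ⟨a, rfl⟩
    | cons p e => simp at h

theorem shortPath_injective :
    Function.Injective (Sum.elim (trivialPath (V := V)) arrowPath) := by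
  refine trivialPath_injective.sumElim arrowPath_injective fun a α h => ?_
  have : (trivialPath a).2.2.length = (arrowPath α).2.2.length := by rw [h]
  exact absurd this (by simp [trivialPath, arrowPath])

theorem mem_range_shortPath (p : AnyPath V) :
    p ∈ Set.range (Sum.elim (trivialPath (V := V)) arrowPath) ↔ p.2.2.length < 2 := by
  constructor
  · rintro ⟨a | α, rfl⟩
    · exact Nat.zero_lt_two
    · simp [arrowPath]
  · obtain ⟨a, b, p⟩ := p
    intro h
    cases p with
    | nil => exact ⟨Sum.inl a, rfl⟩
    | cons p e =>
      cases p with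
      | nil => exact ⟨Sum.inr ⟨a, b, e⟩, rfl⟩
      | cons p e => simp at h

theorem length_eq_zero_or (p : AnyPath V) : (∃ a, p = trivialPath a) ∨ 1 ≤ p.2.2.length := by
  by_cases h : p.2.2.length < 1
  · obtain ⟨a, rfl⟩ := (mem_range_trivialPath p).2 h
    exact Or.inl ⟨a, rfl⟩
  · exact Or.inr (not_lt.1 h)

theorem lengthSpan_antitone {m n : ℕ} (h : m ≤ n) : lengthSpan k V n ≤ lengthSpan k V m :=
  fun _ hx => mem_lengthSpan.2 fun p hp => h.trans (mem_lengthSpan.1 hx p hp)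

variable [Fintype V]

theorem lengthSpan_mul_le (m n : ℕ) :
    lengthSpan k V m * lengthSpan k V n ≤ lengthSpan k V (m + n) := by
  rw [lengthSpan, lengthSpan, Submodule.span_mul_span, Submodule.span_le]
  rintro _ ⟨_, ⟨⟨b, c, p⟩, hp, rfl⟩, _, ⟨⟨a, b', q⟩, hq, rfl⟩, rfl⟩
  change PathAlgebra.path k _ * PathAlgebra.path k _ ∈ lengthSpan k V (m + n)
  rw [PathAlgebra.path_mul_path]
  by_cases h : b' = b
  · subst h
    rw [PathAlgebra.mulPath_comp]
    refine path_mem_lengthSpan ?_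
    change m ≤ p.length at hp
    change n ≤ q.length at hq
    rw [Path.length_comp]
    lia
  · rw [PathAlgebra.mulPath_of_ne h]
    exact zero_mem _

/-- A path of length at least two splits off its last arrow and leaves a path of positive length. -/
theorem lengthSpan_one_mul_self : lengthSpan k V 1 * lengthSpan k V 1 = lengthSpan k V 2 := by
  refine le_antisymm (lengthSpan_mul_le 1 1) ?_
  rw [lengthSpan, Submodule.span_le]
  rintro _ ⟨⟨a, c, p⟩, hp, rfl⟩
  cases p with
  | nil => simp at hp
  | @cons b _ p e =>
    have h : PathAlgebra.path k ⟨a, c, p.cons e⟩ =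
        PathAlgebra.path k (arrowPath ⟨b, c, e⟩) * PathAlgebra.path k ⟨a, b, p⟩ := by
      rw [PathAlgebra.path_mul_path]
      exact (PathAlgebra.mulPath_comp e.toPath p).symm
    rw [h]
    refine Submodule.mul_mem_mul (path_mem_lengthSpan ?_) (path_mem_lengthSpan ?_)
    · simp [arrowPath]
    · simpa using hp

theorem lengthSpan_pow_le (m : ℕ) : lengthSpan k V 1 ^ m ≤ lengthSpan k V m := by
  induction m with
  | zero =>
    intro x _
    exact mem_lengthSpan.2 fun _ _ => Nat.zero_le _
  | succ m ih =>
    rw [pow_succ]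
    exact (mul_le_mul_left ih _).trans (lengthSpan_mul_le m 1)

/-- The coefficients of the trivial paths. -/
abbrev vertexCoeffs : PathAlgebra k V →ₗ[k] (V → k) := pathCoeffs trivialPath

theorem vertexCoeffs_eq_zero {x : PathAlgebra k V} :
    vertexCoeffs x = 0 ↔ x ∈ lengthSpan k V 1 := by
  rw [← ker_pathCoeffs mem_range_trivialPath, LinearMap.mem_ker]

open Classical in
theorem vertexCoeffs_trivialPath (a : V) :
    vertexCoeffs (PathAlgebra.path k (trivialPath a)) = Pi.single a 1 := by
  funext b
  change Finsupp.single (trivialPath a) (1 : k) (trivialPath b) = _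
  rw [Finsupp.single_apply, Pi.single_apply]
  simp only [trivialPath_injective.eq_iff, eq_comm]

theorem vertexCoeffs_path_mul (p q : AnyPath V) :
    vertexCoeffs (PathAlgebra.path k p * PathAlgebra.path k q) =
      vertexCoeffs (PathAlgebra.path k p) * vertexCoeffs (PathAlgebra.path k q) := by
  classical
  have h0 : ∀ x : PathAlgebra k V, x ∈ lengthSpan k V 0 :=
    fun x => mem_lengthSpan.2 fun _ _ => Nat.zero_le _
  rcases length_eq_zero_or p with ⟨a, rfl⟩ | hp
  · rcases length_eq_zero_or q with ⟨b, rfl⟩ | hq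
    · rw [PathAlgebra.path_mul_path, vertexCoeffs_trivialPath, vertexCoeffs_trivialPath]
      by_cases h : b = a
      · subst h
        rw [← Pi.single_mul, mul_one, ← vertexCoeffs_trivialPath]
        exact congrArg _ (PathAlgebra.mulPath_comp _ _)
      · rw [PathAlgebra.mulPath_of_ne h, map_zero]
        funext c
        by_cases hc : c = a
        · subst hc
          simp [Ne.symm h]
        · simp [Pi.single_apply, hc]
    · rw [vertexCoeffs_eq_zero.2 (path_mem_lengthSpan hq), mul_zero, vertexCoeffs_eq_zero]
      exact lengthSpan_mul_le 0 1 (Submodule.mul_mem_mul (h0 _) (path_mem_lengthSpan hq))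
  · rw [vertexCoeffs_eq_zero.2 (path_mem_lengthSpan hp), zero_mul, vertexCoeffs_eq_zero]
    exact lengthSpan_mul_le 1 0 (Submodule.mul_mem_mul (path_mem_lengthSpan hp) (h0 _))

/-- Trivial paths are orthogonal idempotents, and a product involving a longer path has no trivial
component. The values lie in the reduced ring `V → k`, so nilpotents are invisible to
`vertexCoeffs`. -/
theorem vertexCoeffs_mul (x y : PathAlgebra k V) :
    vertexCoeffs (x * y) = vertexCoeffs x * vertexCoeffs y := by
  induction x using PathAlgebra.induction with
  | zero => rw [zero_mul, map_zero, zero_mul]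
  | add x x' hx hx' => rw [add_mul, map_add, hx, hx', map_add, add_mul]
  | smul c p =>
    induction y using PathAlgebra.induction with
    | zero => rw [mul_zero, map_zero, mul_zero]
    | add y y' hy hy' => rw [mul_add, map_add, hy, hy', map_add, mul_add]
    | smul d q =>
      rw [PathAlgebra.smul_mul', PathAlgebra.mul_smul', map_smul, map_smul, map_smul, map_smul,
        vertexCoeffs_path_mul, smul_mul_smul_comm, smul_smul]

/-- Non-trivial paths in `x` lengthen `α`, so only trivial paths can return `α` itself. As products
compose from right to left, a left factor acts at the target of `α`. -/
theorem coeff_mul_arrow (x : PathAlgebra k V) (α : Total V) :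
    (x * PathAlgebra.path k (arrowPath α)).toFinsupp (arrowPath α) = vertexCoeffs x α.right := by
  classical
  induction x using PathAlgebra.induction with
  | zero => rw [zero_mul, map_zero]; rfl
  | add x x' hx hx' =>
    rw [add_mul, map_add, Pi.add_apply, ← hx, ← hx']
    rfl
  | smul c p =>
    rw [PathAlgebra.smul_mul', map_smul, Pi.smul_apply]
    refine congrArg (fun z : k => c * z) ?_
    rcases length_eq_zero_or p with ⟨a, rfl⟩ | hp
    · rw [PathAlgebra.path_mul_path, vertexCoeffs_trivialPath, Pi.single_apply]
      split_ifs with h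
      · subst h
        exact (congrArg (fun z : PathAlgebra k V => z.toFinsupp (arrowPath α))
          (PathAlgebra.mulPath_comp _ _)).trans (Finsupp.single_eq_same ..)
      · rw [PathAlgebra.mulPath_of_ne h]
        rfl
    · rw [vertexCoeffs_eq_zero.2 (path_mem_lengthSpan hp)]
      by_contra h
      have := mem_lengthSpan.1 (lengthSpan_mul_le 1 1 (Submodule.mul_mem_mul
        (path_mem_lengthSpan hp) (path_mem_lengthSpan (p := arrowPath α) (by simp [arrowPath]))))
        _ h
      simp [arrowPath] at this

theorem coeff_arrow_mul (x : PathAlgebra k V) (α : Total V) :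
    (PathAlgebra.path k (arrowPath α) * x).toFinsupp (arrowPath α) = vertexCoeffs x α.left := by
  classical
  induction x using PathAlgebra.induction with
  | zero => rw [mul_zero, map_zero]; rfl
  | add x x' hx hx' =>
    rw [mul_add, map_add, Pi.add_apply, ← hx, ← hx']
    rfl
  | smul c p =>
    rw [PathAlgebra.mul_smul', map_smul, Pi.smul_apply]
    refine congrArg (fun z : k => c * z) ?_
    rcases length_eq_zero_or p with ⟨a, rfl⟩ | hp
    · rw [PathAlgebra.path_mul_path, vertexCoeffs_trivialPath, Pi.single_apply]
      split_ifs with h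
      · subst h
        refine (congrArg (fun z : PathAlgebra k V => z.toFinsupp (arrowPath α))
          (PathAlgebra.mulPath_comp _ _)).trans ?_
        rw [Path.nil_comp]
        exact Finsupp.single_eq_same ..
      · rw [PathAlgebra.mulPath_of_ne (Ne.symm h)]
        rfl
    · rw [vertexCoeffs_eq_zero.2 (path_mem_lengthSpan hp)]
      by_contra h
      have := mem_lengthSpan.1 (lengthSpan_mul_le 1 1 (Submodule.mul_mem_mul
        (path_mem_lengthSpan (p := arrowPath α) (by simp [arrowPath])) (path_mem_lengthSpan hp)))
        _ h
      simp [arrowPath] at this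

/-- The linear combination of trivial paths with given coefficients. -/
def vertexSum (f : V → k) : PathAlgebra k V := ∑ a, f a • PathAlgebra.path k (trivialPath a)

theorem vertexCoeffs_vertexSum (f : V → k) : vertexCoeffs (vertexSum f) = f := by
  classical
  rw [vertexSum, map_sum]
  simp only [map_smul, vertexCoeffs_trivialPath]
  funext b
  simp [Finset.sum_apply, Pi.single_apply]

theorem vertexSum_mul_path (f : V → k) (p : AnyPath V) :
    vertexSum f * PathAlgebra.path k p = f p.2.1 • PathAlgebra.path k p := by
  rw [vertexSum, Finset.sum_mul, Finset.sum_eq_single p.2.1]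
  · rw [PathAlgebra.smul_mul', PathAlgebra.path_mul_path]
    exact congrArg _ (PathAlgebra.mulPath_comp _ _)
  · intro b _ hb
    rw [PathAlgebra.smul_mul', PathAlgebra.path_mul_path, PathAlgebra.mulPath_of_ne hb.symm,
      smul_zero]
  · exact fun h => absurd (Finset.mem_univ _) h

theorem path_mul_vertexSum (f : V → k) (p : AnyPath V) :
    PathAlgebra.path k p * vertexSum f = f p.1 • PathAlgebra.path k p := by
  rw [vertexSum, Finset.mul_sum, Finset.sum_eq_single p.1]
  · rw [PathAlgebra.mul_smul', PathAlgebra.path_mul_path]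
    refine congrArg _ ((PathAlgebra.mulPath_comp _ _).trans ?_)
    rw [Path.nil_comp]
  · intro b _ hb
    rw [PathAlgebra.mul_smul', PathAlgebra.path_mul_path, PathAlgebra.mulPath_of_ne hb,
      smul_zero]
  · exact fun h => absurd (Finset.mem_univ _) h

end PathLength

/-! ### Counting vertices, arrows and components from the algebra. -/

section Invariants

/-- The span of the nilpotent elements of an algebra; for a basic algebra, the radical. -/
def nilSpan (k : Type w) (A : Type t) [Field k] [Ring A] [Algebra k A] : Submodule k A :=
  Submodule.span k {x | IsNilpotent x}

/-- The image of the center modulo the radical. -/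
def centerImage (k : Type w) (A : Type t) [Field k] [Ring A] [Algebra k A] :
    Submodule k (A ⧸ nilSpan k A) :=
  (Subalgebra.toSubmodule (Subalgebra.center k A)).map (nilSpan k A).mkQ

/-- The Betti number of the quiver of a basic algebra, in terms of the algebra. -/
def algebraBetti (k : Type w) (A : Type t) [Field k] [Ring A] [Algebra k A] : ℤ :=
  Module.finrank k (A ⧸ nilSpan k A * nilSpan k A) - 2 * Module.finrank k (A ⧸ nilSpan k A) +
    Module.finrank k (centerImage k A)

variable {k : Type w} {V : Type u} [Field k] [Quiver.{v} V] [Fintype V]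
  {A : Type t} [Ring A] [Algebra k A] {ν : PathAlgebra k V →ₐ[k] A}

theorem IsAdmissiblePresentation.ker_le (hν : IsAdmissiblePresentation ν) {x : PathAlgebra k V}
    (hx : ν x = 0) : x ∈ lengthSpan k V 2 :=
  mem_lengthSpan.2 fun p hp => hν.2.1 x ((TwoSidedIdeal.mem_ker ν).2 hx) p
    (Finsupp.mem_support_iff.2 hp)

/-- Long paths lie in the kernel, so combinations of non-trivial paths become nilpotent. Conversely,
if `ν x` is nilpotent, a power of `x` lies in the kernel, hence has no trivial path, and then
neither has `x`. -/
theorem IsAdmissiblePresentation.map_lengthSpan_one (hν : IsAdmissiblePresentation ν) :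
    (lengthSpan k V 1).map ν.toLinearMap = nilSpan k A := by
  apply le_antisymm
  · rintro _ ⟨x, hx, rfl⟩
    obtain ⟨m, hm⟩ := hν.2.2
    refine Submodule.subset_span ⟨m, ?_⟩
    have h : x ^ m ∈ lengthSpan k V m := lengthSpan_pow_le m (Submodule.pow_mem_pow _ hx m)
    change ν x ^ m = 0
    rw [← map_pow, (x ^ m).eq_sum, map_sum]
    refine Finset.sum_eq_zero fun p hp => ?_
    rw [map_smul, (TwoSidedIdeal.mem_ker ν).1
      (hm p (mem_lengthSpan.1 h p (Finsupp.mem_support_iff.1 hp))), smul_zero]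
  · rw [nilSpan, Submodule.span_le]
    rintro a ⟨n, hn⟩
    obtain ⟨x, rfl⟩ := hν.1 a
    refine ⟨x, vertexCoeffs_eq_zero.1 ?_, rfl⟩
    -- Positive exponents suffice, and multiplicativity alone gives them without the image of `1`.
    have h1 : ∀ n, vertexCoeffs (x ^ (n + 1)) = vertexCoeffs x ^ (n + 1) := fun n => by
      induction n with
      | zero => rw [pow_one, pow_one]
      | succ n ih => rw [pow_succ, vertexCoeffs_mul, ih, ← pow_succ]
    have h2 : ν (x ^ (n + 1)) = 0 := by rw [map_pow, pow_succ, hn, zero_mul]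
    have h3 := h1 n
    rw [vertexCoeffs_eq_zero.2 (lengthSpan_antitone one_le_two (hν.ker_le h2))] at h3
    exact eq_zero_of_pow_eq_zero h3.symm

theorem IsAdmissiblePresentation.map_lengthSpan_two (hν : IsAdmissiblePresentation ν) :
    (lengthSpan k V 2).map ν.toLinearMap = nilSpan k A * nilSpan k A := by
  rw [← lengthSpan_one_mul_self, Submodule.map_mul, hν.map_lengthSpan_one]

/-- The quotient by the image of the span of long paths, in terms of coefficients. -/
theorem IsAdmissiblePresentation.exists_quotient_equiv (hν : IsAdmissiblePresentation ν)
    {ι : Type*} [Finite ι] {j : ι → AnyPath V} (hj : Function.Injective j) {n : ℕ} (hn : n ≤ 2)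
    (hjr : ∀ p : AnyPath V, p ∈ Set.range j ↔ p.2.2.length < n) {R : Submodule k A}
    (hR : (lengthSpan k V n).map ν.toLinearMap = R) :
    ∃ e : (A ⧸ R) ≃ₗ[k] (ι → k), ∀ x, e (R.mkQ (ν x)) = pathCoeffs j x := by
  let f : PathAlgebra k V →ₗ[k] A ⧸ R := R.mkQ.comp ν.toLinearMap
  have hf : Function.Surjective f := R.mkQ_surjective.comp hν.1
  -- The kernel of `f` is the sum of `lengthSpan k V n` and the kernel of `ν`. Admissibility puts
  -- the latter in `lengthSpan k V 2`, and `n ≤ 2` lets the first summand absorb it.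
  have hker : LinearMap.ker f = LinearMap.ker (pathCoeffs (k := k) j) := by
    rw [ker_pathCoeffs hjr, LinearMap.ker_comp, Submodule.ker_mkQ, ← hR, Submodule.comap_map_eq,
      sup_eq_left]
    exact fun x hx => lengthSpan_antitone hn (hν.ker_le hx)
  refine ⟨(f.quotKerEquivOfSurjective hf).symm.trans ((Submodule.quotEquivOfEq _ _ hker).trans
    ((pathCoeffs (k := k) j).quotKerEquivOfSurjective (pathCoeffs_surjective hj))), fun x => ?_⟩
  have h : (f.quotKerEquivOfSurjective hf).symm (R.mkQ (ν x)) = Submodule.Quotient.mk x := by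
    rw [LinearEquiv.symm_apply_eq]
    rfl
  rw [LinearEquiv.trans_apply, h]
  rfl

/-- If `ν x` is central, then `x α` and `α x` differ by paths of length at least two. Comparing
their coefficients at `α` shows that `x` has equal coefficients at both ends of `α`. Conversely, a
vertex function constant on components weights the trivial paths to a central element. -/
theorem IsAdmissiblePresentation.map_centerImage (hν : IsAdmissiblePresentation ν)
    (e : (A ⧸ nilSpan k A) ≃ₗ[k] (V → k))
    (he : ∀ x, e ((nilSpan k A).mkQ (ν x)) = vertexCoeffs x) :
    (centerImage k A).map e.toLinearMap =
      LinearMap.range (LinearMap.funLeft k k (WeaklyConnectedComponent.mk (V := V))) := by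
  apply le_antisymm
  · rintro _ ⟨_, ⟨a, ha, rfl⟩, rfl⟩
    obtain ⟨x, rfl⟩ := hν.1 a
    have hx : ∀ {a b : V} (α : a ⟶ b), vertexCoeffs x a = vertexCoeffs x b := by
      intro a b α
      have hc := (Subalgebra.mem_center_iff (R := k)).1 ha (ν (PathAlgebra.path k (arrowPath ⟨a, b, α⟩)))
      rw [← map_mul, ← map_mul, ← sub_eq_zero, ← map_sub] at hc
      by_contra hne
      have := mem_lengthSpan.1 (hν.ker_le hc) (arrowPath ⟨a, b, α⟩) fun h0 => hne ?_
      · simp [arrowPath] at this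
      · rw [← coeff_arrow_mul x ⟨a, b, α⟩, ← coeff_mul_arrow x ⟨a, b, α⟩, ← sub_eq_zero]
        exact h0
    have hw : ∀ {a b : V} (w : Walk a b), vertexCoeffs x a = vertexCoeffs x b := by
      intro a b w
      induction w using Walk.induction with
      | nil => rfl
      | arrow w α ih => exact ih.trans (hx α)
      | invArrow w α ih => exact ih.trans (hx α).symm
    refine ⟨fun c => vertexCoeffs x (componentBase c), ?_⟩
    refine Eq.trans ?_ (he x).symm
    funext a
    exact hw (walkFromBase _ a rfl)
  · rintro _ ⟨f, rfl⟩
    let g : V → k := LinearMap.funLeft k k (WeaklyConnectedComponent.mk (V := V)) f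
    refine ⟨_, ⟨ν (vertexSum g), ?_, rfl⟩, (he _).trans (vertexCoeffs_vertexSum g)⟩
    refine (Subalgebra.mem_center_iff (R := k)).2 fun a => ?_
    obtain ⟨x, rfl⟩ := hν.1 a
    rw [← map_mul, ← map_mul]
    congr 1
    induction x using PathAlgebra.induction with
    | zero => rw [mul_zero, zero_mul]
    | add x y hx hy => rw [add_mul, mul_add, hx, hy]
    | smul c p =>
      rw [PathAlgebra.smul_mul', PathAlgebra.mul_smul', vertexSum_mul_path, path_mul_vertexSum]
      have : g p.1 = g p.2.1 := congrArg f ((WeaklyConnectedComponent.eq _ _).2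
        ⟨Walk.ofPath p.2.2⟩)
      rw [this]

/-- The Betti number of the quiver in an admissible presentation depends only on the algebra. -/
theorem IsAdmissiblePresentation.betti_eq [∀ a b : V, Finite (a ⟶ b)]
    (hν : IsAdmissiblePresentation ν) : betti V = algebraBetti k A := by
  have := Fintype.ofFinite (Total V)
  have := Fintype.ofFinite (WeaklyConnectedComponent V)
  -- The dimensions found are `n` and `n + m`, and `c` for the image of the center, so
  -- `algebraBetti` becomes `(n + m) - 2n + c`.
  obtain ⟨e₁, he₁⟩ := hν.exists_quotient_equiv trivialPath_injective one_le_two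
    mem_range_trivialPath hν.map_lengthSpan_one
  obtain ⟨e₂, -⟩ := hν.exists_quotient_equiv shortPath_injective le_rfl
    mem_range_shortPath hν.map_lengthSpan_two
  have h3 : Module.finrank k (centerImage k A) = Fintype.card (WeaklyConnectedComponent V) := by
    rw [← LinearEquiv.finrank_map_eq e₁, hν.map_centerImage e₁ he₁,
      LinearMap.finrank_range_of_inj, Module.finrank_fintype_fun_eq_card]
    exact LinearMap.funLeft_injective_of_surjective k k _
      fun c => ⟨componentBase c, component_componentBase c⟩
  rw [betti, algebraBetti, h3, e₁.finrank_eq, e₂.finrank_eq, Module.finrank_fintype_fun_eq_card,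
    Module.finrank_fintype_fun_eq_card, Fintype.card_sum, Nat.card_eq_fintype_card,
    Nat.card_eq_fintype_card, Nat.card_eq_fintype_card]
  push_cast
  ring

/-- The maximum defining the `π₁`-rank of a monomial algebra is attained at a monomial
presentation. -/
theorem IsMonomialPresentation.isGreatest_pi1Dims [∀ a b : V, Finite (a ⟶ b)]
    (hν : IsMonomialPresentation ν) :
    IsGreatest (pi1Dims.{t, w, v, u} k A) (Module.finrank ℤ (cycles V)) := by
  constructor
  · exact ⟨V, inferInstance, inferInstance, inferInstance, ν, hν.1,
      rank_dualGroup_pi1Prod hν.2⟩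
  · rintro d ⟨V', _, _, _, ν', hν', hd⟩
    -- A competing presentation is bounded by the cycles of its own quiver, whose rank agrees with
    -- that of `V` because both Betti numbers are read off from `A`.
    have h1 := rank_dualGroup_pi1Prod_le (k := k) (I := TwoSidedIdeal.ker ν')
    rw [hd, Nat.cast_le] at h1
    have h2 : (Module.finrank ℤ (cycles V') : ℤ) = Module.finrank ℤ (cycles V) := by
      rw [finrank_cycles, finrank_cycles, hν'.betti_eq, hν.1.betti_eq]
    lia

theorem IsMonomialPresentation.pi1Rank_eq [∀ a b : V, Finite (a ⟶ b)]
    (hν : IsMonomialPresentation ν) :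
    pi1Rank.{t, w, v, u} k A = Module.finrank ℤ (cycles V) :=
  hν.isGreatest_pi1Dims.csSup_eq

end Invariants

end QuiverAlg

end

/-! ### The main theorem. -/

theorem mainTheorem8 {k : Type w} [Field k] [IsAlgClosed k]
    {A : Type t} [Ring A] [Algebra k A] {B : Type t} [Ring B] [Algebra k B]
    -- `B` is a subalgebra of `A` (possibly with a different unit)
    (ι : B →ₙₐ[k] A) (hι : Function.Injective ι)
    -- the quiver of `A`, and the quiver of `B` as a subquiver
    {V : Type u} [Fintype V] [Quiver.{v} V] [∀ a b : V, Finite (a ⟶ b)] (QB : Subquiver V)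
    -- a relative presentation `(νA, νB)` by monomial ideals
    (νA : PathAlgebra k V →ₐ[k] A) (hνA : IsMonomialPresentation νA)
    (νB : PathAlgebra k QB.Vert →ₐ[k] B) (hνB : IsMonomialPresentation νB)
    (hν : ∀ x, ι (νB x) = νA (QB.mapAlg x))
    (hA : IsConnectedAlgebra A)
    -- an extended maximal tree, a base point, and walks to the connected components of `Q_B`
    (T : WideSubquiver V) (hT : QB.IsExtendedMaximalTree T)
    (x₀ : V) (γ : ∀ c : Quiver.WeaklyConnectedComponent QB.Vert, Walk x₀ (componentBase c).1) :
    betti (QB.relQuiver T) = betti V - betti QB.Vert ∧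
    (Function.Injective (Subquiver.abMap (Subquiver.compatible_ker hι hν) γ) ∧
      (∃ e : Abelianization (QB.ContractedPi1 (TwoSidedIdeal.ker νA) x₀) ≃*
          Abelianization (Pi1 (TwoSidedIdeal.ker νA) x₀) ⧸
            (Subquiver.abMap (Subquiver.compatible_ker hι hν) γ).range,
        ∀ g : Pi1 (TwoSidedIdeal.ker νA) x₀,
          e (Abelianization.of (QuotientGroup.mk g)) = QuotientGroup.mk (Abelianization.of g)) ∧
      Nonempty (Abelianization (QB.RelPi1 k T x₀) ≃*
        Abelianization (Pi1 (TwoSidedIdeal.ker νA) x₀) ⧸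
          (Subquiver.abMap (Subquiver.compatible_ker hι hν) γ).range)) ∧
    (IsGreatest (pi1Dims.{t, w, v, u} k A) (pi1Rank.{t, w, v, u} k A) ∧
      IsGreatest (pi1Dims.{t, w, v, u} k B) (pi1Rank.{t, w, v, u} k B) ∧
      Module.Finite k (DualGroup k (QB.RelPi1 k T x₀)) ∧
      (Module.finrank k (DualGroup k (QB.RelPi1 k T x₀)) : ℤ) =
        (pi1Rank.{t, w, v, u} k A : ℤ) - pi1Rank.{t, w, v, u} k B) := by
  -- The spanning tree `T` lies in both `Q_A` and `Q_{A|B,T}`, which makes both quivers connected.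
  have hx : ∀ y : V, Nonempty (Walk x₀ y) := fun y => (hT.2.1 x₀ y).nonempty_walk
  have hx' : ∀ y : QB.relQuiver T, Nonempty (Walk (toWide (QB.relQuiver T) x₀) y) := fun y =>
    (hT.2.1 x₀ y).mono fun _ _ _ h => Or.inr h
  have hc := Subquiver.compatible_ker hι hν
  obtain ⟨e⟩ := nonempty_dualGroup_pi1_equiv (k := k)
    (I := (⊥ : TwoSidedIdeal (PathAlgebra k (QB.relQuiver T)))) isMonomialIdeal_bot
    (toWide (QB.relQuiver T) x₀) hx'
  refine ⟨Subquiver.betti_relQuiver hT, ⟨Subquiver.abMap_injective hνB.2 hνA.2 hc γ,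
    exists_abelianization_quotient_equiv _ _
      (Subquiver.map_contractionSubgroup hνB.2 hνA.2 hc hx γ),
    Subquiver.nonempty_relPi1_equiv hνB.2 hνA.2 hc hT hx hx' γ⟩, ?_, ?_,
    Module.Finite.equiv e.symm, ?_⟩
  · rw [hνA.pi1Rank_eq]
    exact hνA.isGreatest_pi1Dims
  · rw [hνB.pi1Rank_eq]
    exact hνB.isGreatest_pi1Dims
  -- All three dimensions are Betti numbers, so this is the first assertion again.
  · rw [e.finrank_eq, Module.finrank_fin_fun, hνA.pi1Rank_eq, hνB.pi1Rank_eq, finrank_cycles,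
      finrank_cycles, finrank_cycles]
    exact Subquiver.betti_relQuiver hT
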